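/- Let $\Delta=\{z\in\mathbb C:|z|<1\}$ and let $\mathcal S$ be the class of analytic injective functions $f:\Delta\to\mathbb C$ with $f(0)=0$ and $f'(0)=1$. For $f\in\mathcal S$ let $$Q_f(z,w)=\frac{f(z)-f(w)}{z-w}\cdot\frac{z}{f(z)}\cdot\frac{w}{f(w)},\qquad z,w\in\Delta,$$ where $\frac{f(z)-f(w)}{z-w}$ is understood as $f'(z)$ for $z=w$ and $\frac{z}{f(z)}$ as $1$ for $z=0$. There is an analytic function $F$ on $\Delta^2$ with $e^{F}=Q_f$ and $F(0,0)=0$ (the analytic branch of $\log Q_f$ that vanishes at the origin; it is unique). For integers $p,q\ge 1$ define the higher-order Schwarzian derivative $$S_f^{[p,q]}(z)=\frac{\partial^{p+q}F}{\partial z^p\,\partial w^q}(z,z),\qquad z\in\Delta.$$ Then, for every $f\in\mathcal S$ and all integers $p,q\ge1$, the function $S_f^{[p,q]}$ is analytic in $\Delta$ and belongs to the growth space $\mathcal B_{p+q}$ of analytic functions $\phi$ on $\Delta$ with $\|\phi\|_{\mathcal B_{p+q}}=\sup_{z\in\Delta}|\phi(z)|(1-|z|^2)^{p+q}<\infty$,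 and $$\|S_f^{[p,q]}\|_{\mathcal B_{p+q}}=\sup_{z\in\Delta}|S_f^{[p,q]}(z)|(1-|z|^2)^{p+q}\le\sqrt{(2p-1)!\,(2q-1)!}.$$ -/

import Mathlib

noncomputable section

namespace HigherSchwarzian

/-- The open unit disk of the complex plane. -/
def unitDisk : Set ℂ := Metric.ball 0 1

/-- The class of functions that are analytic and injective in the unit disk,
normalized by `f 0 = 0` and `f' 0 = 1`. Values outside the disk are irrelevant. -/
structure IsClassS (f : ℂ → ℂ) : Prop where
  analytic : DifferentiableOn ℂ f unitDisk
  injective : Set.InjOn f unitDisk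
  map_zero : f 0 = 0
  deriv_zero : deriv f 0 = 1

/-- The function `(f z - f w) / (z - w) * (z / f z) * (w / f w)`, with its singularities removed:
`(f z - f w) / (z - w)` is read as `deriv f z` when `z = w`, and `z / f z` as `1 / deriv f 0`
when `z = 0`. This is what `dslope` does, since `f 0 = 0`. -/
def quotient (f : ℂ → ℂ) (z w : ℂ) : ℂ :=
  dslope f z w * (dslope f 0 z)⁻¹ * (dslope f 0 w)⁻¹

/-- `F` is the single-valued analytic branch on the bidisk of the logarithm of `quotient f`
that vanishes at the origin. -/
structure IsLogBranch (f : ℂ → ℂ) (F : ℂ × ℂ → ℂ) : Prop where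
  analytic : DifferentiableOn ℂ F (unitDisk ×ˢ unitDisk)
  exp_eq : ∀ z ∈ unitDisk, ∀ w ∈ unitDisk, Complex.exp (F (z, w)) = quotient f z w
  zero : F (0, 0) = 0

/-- The mixed partial derivative `∂^(p+q) F / ∂z^p ∂w^q` at `(z, w)`. -/
def mixedPartial (F : ℂ × ℂ → ℂ) (p q : ℕ) (z w : ℂ) : ℂ :=
  iteratedDeriv p (fun ζ => iteratedDeriv q (fun ω => F (ζ, ω)) w) z

/-- The higher-order Schwarzian derivative: the mixed partial derivative on the diagonal. -/
def schwarzian (F : ℂ × ℂ → ℂ) (p q : ℕ) (z : ℂ) : ℂ :=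
  mixedPartial F p q z z

/-- The weighted supremum norm of the growth space of exponent `γ`. -/
def growthNorm (γ : ℝ) (φ : ℂ → ℂ) : ℝ :=
  ⨆ z : unitDisk, ‖φ z‖ * (1 - ‖(z : ℂ)‖ ^ 2) ^ γ

/-- Membership in the growth space of exponent `γ`: analytic in the disk, with finite norm. -/
structure MemGrowth (γ : ℝ) (φ : ℂ → ℂ) : Prop where
  analytic : DifferentiableOn ℂ φ unitDisk
  bounded : BddAbove (Set.range fun z : unitDisk => ‖φ z‖ * (1 - ‖(z : ℂ)‖ ^ 2) ^ γ)

end HigherSchwarzian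

end

/-
The functions `h = r / f (r e^{iθ})` and `u = e^{iθ}` on the circle are related by
`‖h t - h s‖ = ‖u t - u s‖ * exp (Re F)`, so `Re F` is the difference of two logarithmic kernels.
Against a real charge of total mass zero the kernel `log ‖h t - h s‖` is negative: after the
regularization `log (‖h t - h s‖² + ε)` it is, up to terms depending on one variable only,
`log (1 - k)` for a Gram kernel `k` with `|k| < 1`, and all powers of a Gram kernel are positive.
On the circle the energy `-log ‖u t - u s‖` is diagonalized by the Fourier modes. This bounds the
form `Re F` on real charges by `∑ |xₖ|² / k`, which polarizes to the strong Grunsky inequality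
`|F(X, Y)| ≤ ‖X‖ ‖Y‖` for complex charges without nonnegative frequencies. By Cauchy's formula the
mixed derivative of `F` is this form at two kernels `p! ζ / (ζ - z)^(p + 1)`, whose energy is at
most `(2p - 1)! (r / (r² - |z|²))^(2p)`; finally `r → 1`.
-/

open Set Filter Topology MeasureTheory
open scoped ComplexConjugate

namespace HigherSchwarzian

section ParametricIntegral

variable {T : Type*} [TopologicalSpace T] [CompactSpace T] [MeasurableSpace T] [BorelSpace T]
  {μ : Measure T} {g : T → ℂ}

theorem integrable_mul_of_continuous (hg : Integrable g μ) {k : T → ℂ} (hk : Continuous k) :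
    Integrable (fun t => g t * k t) μ := by
  obtain ⟨C, hC⟩ := isCompact_univ.exists_bound_of_continuousOn hk.continuousOn
  exact hg.mul_bdd hk.aestronglyMeasurable (ae_of_all μ fun t => hC t (mem_univ t))

variable [SecondCountableTopology T]

theorem hasFDerivAt_integral_mul {E : Type*} [NormedAddCommGroup E] [NormedSpace ℂ E]
    [ProperSpace E] {V : Set E} (hV : IsOpen V) {K : E → T → ℂ} {K' : E → T → E →L[ℂ] ℂ}
    (hK : ∀ x ∈ V, Continuous (K x))
    (hK' : ContinuousOn (fun y : E × T => K' y.1 y.2) (V ×ˢ univ))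
    (hd : ∀ t, ∀ x ∈ V, HasFDerivAt (fun x => K x t) (K' x t) x) (hg : Integrable g μ)
    {x₀ : E} (hx₀ : x₀ ∈ V) :
    HasFDerivAt (fun x => ∫ t, g t * K x t ∂μ) (∫ t, g t • K' x₀ t ∂μ) x₀ := by
  obtain ⟨ε, hε, hball⟩ := Metric.nhds_basis_closedBall.mem_iff.1 (hV.mem_nhds hx₀)
  obtain ⟨C, hC⟩ := ((isCompact_closedBall x₀ ε).prod isCompact_univ).exists_bound_of_continuousOn
    (hK'.mono (prod_mono_left hball))
  have hK'₀ : Continuous (K' x₀) :=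
    hK'.comp_continuous (Continuous.prodMk_right x₀) fun t => ⟨hx₀, mem_univ t⟩
  refine hasFDerivAt_integral_of_dominated_of_fderiv_le (bound := fun t => ‖g t‖ * C)
    (F' := fun x t => g t • K' x t) (Metric.closedBall_mem_nhds x₀ hε) ?_ ?_
    (hg.aestronglyMeasurable.smul hK'₀.aestronglyMeasurable) ?_ (hg.norm.mul_const C) ?_
  · filter_upwards [hV.mem_nhds hx₀] with x hx using
      hg.aestronglyMeasurable.mul (hK x hx).aestronglyMeasurable
  · exact integrable_mul_of_continuous hg (hK x₀ hx₀)
  · refine ae_of_all μ fun t x hx => ?_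
    rw [norm_smul]
    exact mul_le_mul_of_nonneg_left (hC (x, t) ⟨hx, mem_univ t⟩) (norm_nonneg _)
  · exact ae_of_all μ fun t x hx => (hd t x (hball hx)).const_mul (g t)

theorem hasDerivAt_integral_mul {V : Set ℂ} (hV : IsOpen V) {K K' : ℂ → T → ℂ}
    (hK : ∀ z ∈ V, Continuous (K z))
    (hK' : ContinuousOn (fun y : ℂ × T => K' y.1 y.2) (V ×ˢ univ))
    (hd : ∀ t, ∀ z ∈ V, HasDerivAt (fun z => K z t) (K' z t) z) (hg : Integrable g μ)
    {z₀ : ℂ} (hz₀ : z₀ ∈ V) :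
    HasDerivAt (fun z => ∫ t, g t * K z t ∂μ) (∫ t, g t * K' z₀ t ∂μ) z₀ := by
  let L : ℂ ≃L[ℂ] (ℂ →L[ℂ] ℂ) := ContinuousLinearMap.toSpanSingletonCLE
  have h := (hasFDerivAt_integral_mul hV hK (K' := fun z t => L (K' z t))
    (L.continuous.comp_continuousOn hK') (fun t z hz => (hd t z hz).hasFDerivAt) hg hz₀).hasDerivAt
  simp_rw [← map_smul, L.integral_comp_comm] at h
  simpa [L] using h

end ParametricIntegral

section Injective

variable {f : ℂ → ℂ} {U : Set ℂ}

theorem eventually_deriv_ne_zero_of_injOn (hU : IsOpen U) (hf : DifferentiableOn ℂ f U)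
    (hinj : InjOn f U) {a : ℂ} (ha : a ∈ U) : ∀ᶠ z in 𝓝[≠] a, deriv f z ≠ 0 := by
  have haU := hU.mem_nhds ha
  refine ((hf.deriv hU).analyticAt haU).eventually_eq_zero_or_eventually_ne_zero.resolve_left
    fun h => ?_
  obtain ⟨ε, hε, hball⟩ := Metric.eventually_nhds_iff_ball.1 (h.and haU)
  obtain ⟨z, hz, hza⟩ : ∃ z ∈ Metric.ball a ε, z ≠ a :=
    ((frequently_mem_iff_neBot.2 (inferInstanceAs (𝓝[≠] a).NeBot)).and_eventually
      (Metric.ball_mem_nhds a hε)).exists.imp fun _ h => ⟨h.2, h.1⟩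
  have hconst : f z = f a := Metric.isOpen_ball.is_const_of_deriv_eq_zero
    (convex_ball a ε).isPreconnected (hf.mono fun z hz => (hball z hz).2)
    (fun z hz => (hball z hz).1) hz (Metric.mem_ball_self hε)
  exact hza (hinj (hball z hz).2 ha hconst)

theorem dslope_ne_zero_of_deriv_ne_zero (hinj : InjOn f U) {z w : ℂ} (hz : z ∈ U) (hw : w ∈ U)
    (hd : deriv f z ≠ 0) : dslope f z w ≠ 0 := by
  obtain rfl | hwz := eq_or_ne w z
  · rwa [dslope_same]
  · rw [dslope_of_ne _ hwz, slope_def_field]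
    exact div_ne_zero (sub_ne_zero.2 (hinj.ne hw hz hwz)) (sub_ne_zero.2 hwz)

theorem le_norm_of_forall_mem_sphere_le_norm {g : ℂ → ℂ} {a : ℂ} {δ c : ℝ} (hδ : 0 < δ)
    (hc : 0 < c) (hg : DifferentiableOn ℂ g (Metric.closedBall a δ))
    (hne : ∀ w ∈ Metric.closedBall a δ, g w ≠ 0) (hle : ∀ w ∈ Metric.sphere a δ, c ≤ ‖g w‖) :
    c ≤ ‖g a‖ := by
  have hinv : DiffContOnCl ℂ (fun w => (g w)⁻¹) (Metric.ball a δ) := by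
    refine DifferentiableOn.diffContOnCl ?_
    rw [closure_ball _ hδ.ne']
    exact hg.inv hne
  have hmax := Complex.norm_le_of_forall_mem_frontier_norm_le (C := c⁻¹) Metric.isBounded_ball hinv
    (fun w hw => by
      rw [frontier_ball _ hδ.ne'] at hw
      rw [norm_inv]
      exact inv_anti₀ hc (hle w hw)) (subset_closure (Metric.mem_ball_self hδ))
  rw [norm_inv] at hmax
  exact (inv_le_inv₀ (norm_pos_iff.2 (hne a (Metric.mem_closedBall_self hδ.le))) hc).1 hmax

theorem exists_pos_le_norm_slope_of_injOn (hU : IsOpen U) (hf : DifferentiableOn ℂ f U)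
    (hinj : InjOn f U) {a : ℂ} (ha : a ∈ U) : ∃ c > 0, ∀ᶠ z in 𝓝[≠] a, c ≤ ‖slope f a z‖ := by
  obtain ⟨δ, hδ, hsub⟩ := Metric.nhds_basis_closedBall.mem_iff.1 (hU.mem_nhds ha)
  have hsphere := Metric.sphere_subset_closedBall.trans hsub
  obtain ⟨w₀, hw₀, hmin⟩ := (isCompact_sphere a δ).exists_isMinOn
    (NormedSpace.sphere_nonempty.2 hδ.le)
    ((hf.continuousOn.mono hsphere).sub continuousOn_const).norm (f := fun w => ‖f w - f a‖)
  set m := ‖f w₀ - f a‖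
  have hm : 0 < m := norm_sub_pos_iff.2
    (hinj.ne (hsphere hw₀) ha (Metric.ne_of_mem_sphere hw₀ hδ.ne'))
  have hclose : ∀ᶠ z in 𝓝 a, ‖f z - f a‖ < m / 2 := by
    have hfa := (hf.continuousOn.continuousAt (hU.mem_nhds ha)).sub_const (f a)
    exact hfa.norm.eventually_lt_const (by simpa using half_pos hm)
  refine ⟨m / (4 * δ), by positivity, ?_⟩
  filter_upwards [nhdsWithin_le_nhds hclose, nhdsWithin_le_nhds (Metric.ball_mem_nhds a hδ),
    eventually_deriv_ne_zero_of_injOn hU hf hinj ha, self_mem_nhdsWithin] with z hfz hz hdz hza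
  have hzU : z ∈ U := hsub (Metric.ball_subset_closedBall hz)
  have hdiff : DifferentiableOn ℂ (dslope f z) (Metric.closedBall a δ) :=
    ((Complex.differentiableOn_dslope (hU.mem_nhds hzU)).2 hf).mono hsub
  have hsphere_le (w : ℂ) (hw : w ∈ Metric.sphere a δ) : m / (4 * δ) ≤ ‖dslope f z w‖ := by
    have hwz : w ≠ z := by
      rintro rfl
      exact (Metric.mem_ball.1 hz).ne hw
    have hnum : m / 2 ≤ ‖f w - f z‖ := by
      have h := norm_sub_le_norm_sub_add_norm_sub (f w) (f z) (f a)
      have hmw : m ≤ ‖f w - f a‖ := hmin hw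
      linarith
    have hden : ‖w - z‖ ≤ 2 * δ := by
      rw [← dist_eq_norm]
      linarith [dist_triangle_right w z a, Metric.mem_sphere.1 hw, Metric.mem_ball.1 hz]
    rw [dslope_of_ne _ hwz, slope_def_field, norm_div,
      show m / (4 * δ) = m / 2 / (2 * δ) by field_simp; norm_num]
    exact div_le_div₀ (norm_nonneg _) hnum (norm_pos_iff.2 (sub_ne_zero.2 hwz)) hden
  rw [slope_comm, ← dslope_of_ne _ (Ne.symm hza)]
  exact le_norm_of_forall_mem_sphere_le_norm hδ (by positivity) hdiff
    (fun w hw => dslope_ne_zero_of_deriv_ne_zero hinj hzU (hsub hw) hdz) hsphere_le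

theorem deriv_ne_zero_of_injOn (hU : IsOpen U) (hf : DifferentiableOn ℂ f U) (hinj : InjOn f U)
    {a : ℂ} (ha : a ∈ U) : deriv f a ≠ 0 := by
  obtain ⟨c, hc, hle⟩ := exists_pos_le_norm_slope_of_injOn hU hf hinj ha
  have hlim := ((hf.differentiableAt (hU.mem_nhds ha)).hasDerivAt.tendsto_slope).norm
  exact norm_pos_iff.1 (hc.trans_le (ge_of_tendsto hlim hle))

theorem dslope_ne_zero_of_injOn (hU : IsOpen U) (hf : DifferentiableOn ℂ f U) (hinj : InjOn f U)
    {z w : ℂ} (hz : z ∈ U) (hw : w ∈ U) : dslope f z w ≠ 0 :=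
  dslope_ne_zero_of_deriv_ne_zero hinj hz hw (deriv_ne_zero_of_injOn hU hf hinj hz)

end Injective

section Dslope

theorem dslope_comm (f : ℂ → ℂ) (z w : ℂ) : dslope f z w = dslope f w z := by
  obtain rfl | hwz := eq_or_ne w z
  · rfl
  · rw [dslope_of_ne _ hwz, dslope_of_ne _ hwz.symm, slope_comm]

variable {f : ℂ → ℂ} {U : Set ℂ}

theorem dslope_eq_integral (hU : IsOpen U) (hconv : Convex ℝ U) (hf : DifferentiableOn ℂ f U)
    {z w : ℂ} (hz : z ∈ U) (hw : w ∈ U) :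
    dslope f z w = ∫ t : unitInterval, deriv f (z + ((t : ℝ) : ℂ) * (w - z)) := by
  obtain rfl | hne := eq_or_ne w z
  · simp
  have hseg (t : ℝ) (ht : t ∈ Icc (0 : ℝ) 1) : z + t • (w - z) ∈ U :=
    hconv.add_smul_sub_mem hz hw ht
  have hderiv : DifferentiableOn ℂ (deriv f) U := hf.deriv hU
  have key := intervalIntegral.integral_unitInterval_deriv_eq_sub (f := f) (f' := deriv f)
    (z₀ := z) (z₁ := w - z) (hderiv.continuousOn.comp (by fun_prop) hseg)
    fun t ht => (hf.differentiableAt (hU.mem_nhds (hseg t ht))).hasDerivAt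
  have hI : ∫ t : unitInterval, deriv f (z + ((t : ℝ) : ℂ) * (w - z)) =
      ∫ t in (0 : ℝ)..1, deriv f (z + t • (w - z)) := by
    rw [intervalIntegral.integral_of_le zero_le_one, ← integral_Icc_eq_integral_Ioc,
      ← unitInterval.measurePreserving_coe.integral_comp unitInterval.measurableEmbedding_coe]
    simp only [Complex.real_smul]
  rw [hI, dslope_of_ne _ hne, slope_def_field, div_eq_iff (sub_ne_zero.2 hne), mul_comm,
    ← smul_eq_mul, key, add_sub_cancel]

theorem differentiableOn_dslope_prod (hU : IsOpen U) (hconv : Convex ℝ U)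
    (hf : DifferentiableOn ℂ f U) :
    DifferentiableOn ℂ (fun x : ℂ × ℂ => dslope f x.1 x.2) (U ×ˢ U) := by
  intro x₀ hx₀
  let γ (x : ℂ × ℂ) (t : unitInterval) : ℂ := x.1 + ((t : ℝ) : ℂ) * (x.2 - x.1)
  let L (t : unitInterval) : ℂ × ℂ →L[ℂ] ℂ := ContinuousLinearMap.fst ℂ ℂ ℂ +
    ((t : ℝ) : ℂ) • (ContinuousLinearMap.snd ℂ ℂ ℂ - ContinuousLinearMap.fst ℂ ℂ ℂ)
  have hγ : Continuous fun y : (ℂ × ℂ) × unitInterval => γ y.1 y.2 := by fun_prop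
  have hγU (x : ℂ × ℂ) (hx : x ∈ U ×ˢ U) (t : unitInterval) : γ x t ∈ U := by
    simpa [γ] using hconv.add_smul_sub_mem hx.1 hx.2 t.2
  have hγd (t : unitInterval) (x : ℂ × ℂ) : HasFDerivAt (fun x => γ x t) (L t) x :=
    hasFDerivAt_fst.add ((hasFDerivAt_snd.sub hasFDerivAt_fst).const_mul _)
  have hd1 : DifferentiableOn ℂ (deriv f) U := hf.deriv hU
  have hd2 : ContinuousOn (deriv (deriv f)) U := (hd1.deriv hU).continuousOn
  have hK (x : ℂ × ℂ) (hx : x ∈ U ×ˢ U) : Continuous fun t => deriv f (γ x t) :=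
    hd1.continuousOn.comp_continuous (hγ.comp (Continuous.prodMk_right x)) (hγU x hx)
  have hL : Continuous fun y : (ℂ × ℂ) × unitInterval => L y.2 := by fun_prop
  have hK' : ContinuousOn (fun y : (ℂ × ℂ) × unitInterval => deriv (deriv f) (γ y.1 y.2) • L y.2)
      ((U ×ˢ U) ×ˢ univ) :=
    (hd2.comp hγ.continuousOn fun y hy => hγU y.1 hy.1 y.2).smul hL.continuousOn
  have hd (t : unitInterval) (x : ℂ × ℂ) (hx : x ∈ U ×ˢ U) :
      HasFDerivAt (fun x => deriv f (γ x t)) (deriv (deriv f) (γ x t) • L t) x :=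
    HasDerivAt.comp_hasFDerivAt (f := fun x => γ x t) x
      (hd1.differentiableAt (hU.mem_nhds (hγU x hx t))).hasDerivAt (hγd t x)
  have hint := hasFDerivAt_integral_mul (μ := (volume : Measure unitInterval))
    (hU.prod hU) hK hK' hd (integrable_const (1 : ℂ)) hx₀
  refine (hint.differentiableAt.congr_of_eventuallyEq ?_).differentiableWithinAt
  filter_upwards [(hU.prod hU).mem_nhds hx₀] with x hx
  simpa only [one_mul] using dslope_eq_integral hU hconv hf hx.1 hx.2

end Dslope

section LogBranch

theorem differentiableAt_of_exp_eq {E : Type*} [NormedAddCommGroup E] [NormedSpace ℂ E]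
    {F Q : E → ℂ} {x : E} (hF : ContinuousAt F x) (hQ : DifferentiableAt ℂ Q x)
    (h : ∀ᶠ y in 𝓝 x, Complex.exp (F y) = Q y) : DifferentiableAt ℂ F x := by
  have hQx : Q x ≠ 0 := h.self_of_nhds ▸ Complex.exp_ne_zero _
  have hlog : DifferentiableAt ℂ (fun y => F x + Complex.log (Q y * (Q x)⁻¹)) x :=
    (DifferentiableAt.clog (hQ.mul_const _) (by simp [hQx])).const_add _
  refine hlog.congr_of_eventuallyEq ?_
  have him : ContinuousAt (fun y => (F y - F x).im) x :=
    Complex.continuous_im.continuousAt.comp (hF.sub continuousAt_const)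
  filter_upwards [h, him.eventually (isOpen_Ioo.mem_nhds (by simp [Real.pi_pos] :
    (F x - F x).im ∈ Ioo (-Real.pi) Real.pi))] with y hy hy_im
  rw [← hy, ← h.self_of_nhds, ← div_eq_mul_inv, ← Complex.exp_sub,
    Complex.log_exp hy_im.1 hy_im.2.le, add_sub_cancel]

theorem exists_differentiableOn_exp_eq {E : Type*} [NormedAddCommGroup E] [NormedSpace ℂ E]
    {U : Set E} (hU : IsOpen U) (hconv : Convex ℝ U) {Q : E → ℂ} (hQ : DifferentiableOn ℂ Q U)
    (hQ0 : ∀ x ∈ U, Q x ≠ 0) {x₀ : E} (hx₀ : x₀ ∈ U) (h1 : Q x₀ = 1) :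
    ∃ F : E → ℂ, DifferentiableOn ℂ F U ∧ (∀ x ∈ U, Complex.exp (F x) = Q x) ∧ F x₀ = 0 := by
  have hsc : IsSimplyConnected U := by
    have := hconv.contractibleSpace ⟨x₀, hx₀⟩
    exact SimplyConnectedSpace.ofContractible _
  obtain ⟨G, hGc, hG⟩ := Complex.exists_continuousOn_eqOn_exp_comp hsc hU hQ.continuousOn
    (by rintro ⟨x, hx, h⟩; exact hQ0 x hx h)
  refine ⟨fun x => G x - G x₀, fun x hx => ?_, fun x hx => ?_, sub_self _⟩
  · refine ((differentiableAt_of_exp_eq (hGc.continuousAt (hU.mem_nhds hx))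
      (hQ.differentiableAt (hU.mem_nhds hx)) ?_).sub_const _).differentiableWithinAt
    filter_upwards [hU.mem_nhds hx] with y hy using hG hy
  · rw [Complex.exp_sub, show Complex.exp (G x₀) = 1 from (hG hx₀).trans h1, div_one]
    exact hG hx

theorem exists_isLogBranch {f : ℂ → ℂ} (hf : IsClassS f) : ∃ F, IsLogBranch f F := by
  have hopen : IsOpen unitDisk := Metric.isOpen_ball
  have hconv : Convex ℝ unitDisk := convex_ball 0 1
  have h0 : (0 : ℂ) ∈ unitDisk := Metric.mem_ball_self one_pos
  have hne {z w : ℂ} (hz : z ∈ unitDisk) (hw : w ∈ unitDisk) : dslope f z w ≠ 0 :=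
    dslope_ne_zero_of_injOn hopen hf.analytic hf.injective hz hw
  have hd0 : DifferentiableOn ℂ (dslope f 0) unitDisk :=
    (Complex.differentiableOn_dslope (hopen.mem_nhds h0)).2 hf.analytic
  have hQ : DifferentiableOn ℂ (fun x : ℂ × ℂ => quotient f x.1 x.2) (unitDisk ×ˢ unitDisk) :=
    ((differentiableOn_dslope_prod hopen hconv hf.analytic).mul
      ((hd0.comp differentiableOn_fst fun x hx => hx.1).inv fun x hx => hne h0 hx.1)).mul
      ((hd0.comp differentiableOn_snd fun x hx => hx.2).inv fun x hx => hne h0 hx.2)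
  have hQ0 (x : ℂ × ℂ) (hx : x ∈ unitDisk ×ˢ unitDisk) : quotient f x.1 x.2 ≠ 0 :=
    mul_ne_zero (mul_ne_zero (hne hx.1 hx.2) (inv_ne_zero (hne h0 hx.1)))
      (inv_ne_zero (hne h0 hx.2))
  obtain ⟨F, hFd, hF, hF0⟩ := exists_differentiableOn_exp_eq (hopen.prod hopen)
    (hconv.prod hconv) hQ hQ0 (x₀ := (0, 0)) ⟨h0, h0⟩ (by simp [quotient, hf.deriv_zero])
  exact ⟨F, hFd, fun z hz w hw => hF (z, w) ⟨hz, hw⟩, hF0⟩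

end LogBranch

theorem integrable_of_continuous {X E : Type*} [TopologicalSpace X] [CompactSpace X]
    [MeasurableSpace X] [OpensMeasurableSpace X] {ν : Measure X} [IsFiniteMeasure ν]
    [NormedAddCommGroup E] {g : X → E} (hg : Continuous g) : Integrable g ν :=
  hg.integrable_of_hasCompactSupport (HasCompactSupport.of_compactSpace g)

theorem hasSum_integral_mul_of_geometric_bound {X : Type*} [TopologicalSpace X] [CompactSpace X]
    [MeasurableSpace X] [OpensMeasurableSpace X] {ν : Measure X} [IsFiniteMeasure ν]
    {g : ℕ → X → ℝ} {s w : X → ℝ} (hg : ∀ n, Continuous (g n))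
    (hw : Continuous w) {a : ℝ} (ha0 : 0 ≤ a) (ha1 : a < 1) (hbound : ∀ n y, |g n y| ≤ a ^ n)
    (hsum : ∀ y, HasSum (fun n => g n y) (s y)) :
    HasSum (fun n => ∫ y, g n y * w y ∂ν) (∫ y, s y * w y ∂ν) := by
  refine hasSum_integral_of_dominated_convergence (fun n y => a ^ n * ‖w y‖)
    (fun n => ((hg n).mul hw).aestronglyMeasurable) (fun n => .of_forall fun y => ?_)
    (.of_forall fun y => (summable_geometric_of_lt_one ha0 ha1).mul_right _)
    ?_ (.of_forall fun y => (hsum y).mul_right _)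
  · rw [norm_mul]
    exact mul_le_mul_of_nonneg_right (hbound n y) (norm_nonneg _)
  · simp_rw [tsum_mul_right]
    exact integrable_of_continuous (by fun_prop)

theorem exists_abs_le_lt_one {X : Type*} [TopologicalSpace X] [CompactSpace X] {k : X → ℝ}
    (hk : Continuous k) (hk1 : ∀ y, |k y| < 1) : ∃ a, 0 ≤ a ∧ a < 1 ∧ ∀ y, |k y| ≤ a := by
  rcases isEmpty_or_nonempty X with h | h
  · exact ⟨0, le_rfl, one_pos, fun y => h.elim y⟩
  · obtain ⟨y₀, -, hy₀⟩ := isCompact_univ.exists_isMaxOn univ_nonempty hk.abs.continuousOn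
    exact ⟨|k y₀|, abs_nonneg _, hk1 _, fun y => hy₀ (mem_univ y)⟩

theorem integral_fst_mul_prod_eq_zero {T : Type*} [MeasurableSpace T] {μ : Measure T} [SFinite μ]
    {x : T → ℝ} (hx0 : ∫ t, x t ∂μ = 0) (g : T → ℝ) :
    ∫ y, g y.1 * (x y.1 * x y.2) ∂(μ.prod μ) = 0 := by
  simp_rw [← mul_assoc]
  rw [integral_prod_mul (fun t => g t * x t) x, hx0, mul_zero]

theorem integral_snd_mul_prod_eq_zero {T : Type*} [MeasurableSpace T] {μ : Measure T} [SFinite μ]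
    {x : T → ℝ} (hx0 : ∫ t, x t ∂μ = 0) (g : T → ℝ) :
    ∫ y, g y.2 * (x y.1 * x y.2) ∂(μ.prod μ) = 0 := by
  simp_rw [mul_left_comm]
  rw [integral_prod_mul x (fun t => g t * x t), hx0, zero_mul]

/-- Four functions whose Gram kernel `k` satisfies
`1 - k(a, b) = (‖a - b‖ ^ 2 + ε) / ((1 + ‖a‖ ^ 2) * (1 + ‖b‖ ^ 2))`; for `ε = 1` the last three
are an affine form of the stereographic projection. -/
noncomputable def sphereCoord (ε : ℝ) (a : ℂ) : Fin 4 → ℝ :=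
  ![√(1 - ε) / (1 + ‖a‖ ^ 2), ‖a‖ ^ 2 / (1 + ‖a‖ ^ 2), √2 * a.re / (1 + ‖a‖ ^ 2),
    √2 * a.im / (1 + ‖a‖ ^ 2)]

theorem continuous_sphereCoord (ε : ℝ) (i : Fin 4) : Continuous fun a => sphereCoord ε a i := by
  have hne (a : ℂ) : 1 + ‖a‖ ^ 2 ≠ 0 := by positivity
  fin_cases i <;> exact Continuous.div (by fun_prop) (by fun_prop) hne

theorem one_sub_sum_sphereCoord {ε : ℝ} (hε : ε ≤ 1) (a b : ℂ) :
    1 - ∑ i, sphereCoord ε a i * sphereCoord ε b i =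
      (‖a - b‖ ^ 2 + ε) / ((1 + ‖a‖ ^ 2) * (1 + ‖b‖ ^ 2)) := by
  have h1 : √(1 - ε) * √(1 - ε) = 1 - ε := Real.mul_self_sqrt (by linarith)
  have h2 : √2 * √2 = (2 : ℝ) := Real.mul_self_sqrt (by norm_num)
  have ha : 1 + ‖a‖ ^ 2 ≠ 0 := by positivity
  have hb : 1 + ‖b‖ ^ 2 ≠ 0 := by positivity
  have hab : ‖a - b‖ ^ 2 = ‖a‖ ^ 2 + ‖b‖ ^ 2 - 2 * (a.re * b.re + a.im * b.im) := by
    simp only [← Complex.normSq_eq_norm_sq, Complex.normSq_apply, Complex.sub_re, Complex.sub_im]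
    ring
  simp only [sphereCoord, Fin.sum_univ_four, Matrix.cons_val]
  rw [hab]
  field_simp
  linear_combination -h1 - (a.re * b.re + a.im * b.im) * h2

theorem abs_sum_sphereCoord_lt_one {ε : ℝ} (hε0 : 0 < ε) (hε : ε ≤ 1) (a b : ℂ) :
    |∑ i, sphereCoord ε a i * sphereCoord ε b i| < 1 := by
  have diag (c : ℂ) : ∑ i, sphereCoord ε c i ^ 2 < 1 := by
    have h := one_sub_sum_sphereCoord hε c c
    have : 0 < (‖c - c‖ ^ 2 + ε) / ((1 + ‖c‖ ^ 2) * (1 + ‖c‖ ^ 2)) := by positivity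
    simp_rw [sq]
    linarith
  refine abs_lt_of_sq_lt_sq ?_ zero_le_one
  calc (∑ i, sphereCoord ε a i * sphereCoord ε b i) ^ 2
      ≤ (∑ i, sphereCoord ε a i ^ 2) * ∑ i, sphereCoord ε b i ^ 2 :=
        Finset.sum_mul_sq_le_sq_mul_sq ..
    _ < 1 ^ 2 := by
        rw [one_pow]
        exact mul_lt_one_of_nonneg_of_lt_one_left
          (Finset.sum_nonneg fun i _ => sq_nonneg _) (diag a) (diag b).le

theorem hasSum_neg_log_norm_one_sub {z : ℂ} (hz : ‖z‖ < 1) :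
    HasSum (fun n : ℕ => (z ^ n).re / n) (-Real.log ‖1 - z‖) := by
  simpa only [Complex.div_natCast_re, Complex.neg_re, Complex.log_re] using
    Complex.hasSum_re (Complex.hasSum_taylorSeries_neg_log hz)

theorem norm_sub_sq_add_eq {a b : ℂ} (ha : ‖a‖ = 1) (hb : ‖b‖ = 1) {ρ : ℝ} (hρ : 0 < ρ) :
    ‖a - b‖ ^ 2 + (1 - ρ) ^ 2 / ρ = ‖1 - ρ * (a * conj b)‖ ^ 2 / ρ := by
  have re_sq_add_im_sq {c : ℂ} (hc : ‖c‖ = 1) : c.re ^ 2 + c.im ^ 2 = 1 := by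
    rw [sq, sq, ← Complex.normSq_apply, Complex.normSq_eq_norm_sq, hc, one_pow]
  rw [eq_div_iff hρ.ne', add_mul, div_mul_cancel₀ _ hρ.ne']
  simp only [← Complex.normSq_eq_norm_sq, Complex.normSq_apply, Complex.sub_re, Complex.sub_im,
    Complex.mul_re, Complex.mul_im, Complex.conj_re, Complex.conj_im, Complex.ofReal_re,
    Complex.ofReal_im, Complex.one_re, Complex.one_im]
  linear_combination (ρ - ρ ^ 2 * (b.re ^ 2 + b.im ^ 2)) * re_sq_add_im_sq ha +
    (ρ - ρ ^ 2) * re_sq_add_im_sq hb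

theorem abs_log_mul_exp_add_sub_log_add_le {τ φ ε : ℝ} (hτ : 0 ≤ τ) (hε : 0 < ε) :
    |Real.log (τ * Real.exp φ + ε) - Real.log (τ + ε)| ≤ |φ| := by
  wlog hφ : 0 ≤ φ generalizing τ φ
  · have := this (τ := τ * Real.exp φ) (φ := -φ) (by positivity) (by linarith)
    rwa [mul_assoc, ← Real.exp_add, add_neg_cancel, Real.exp_zero, mul_one, abs_sub_comm,
      abs_neg] at this
  have one_le : 1 ≤ Real.exp φ := Real.one_le_exp hφ
  have lower : Real.log (τ + ε) ≤ Real.log (τ * Real.exp φ + ε) :=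
    Real.log_le_log (by positivity) (by nlinarith)
  have upper : Real.log (τ * Real.exp φ + ε) ≤ Real.log (τ + ε) + φ := by
    rw [← Real.log_exp φ, ← Real.log_mul (by positivity) (by positivity), Real.log_exp]
    exact Real.log_le_log (by positivity) (by nlinarith)
  rw [abs_of_nonneg (by linarith), abs_of_nonneg hφ]
  linarith

theorem ae_prod_ne_of_injective {T E : Type*} [TopologicalSpace T] [SecondCountableTopology T]
    [MeasurableSpace T] [OpensMeasurableSpace T] {μ : Measure T} [SFinite μ]
    [NullSingletonClass μ] [TopologicalSpace E] [T2Space E] {u : T → E} (hu : Continuous u)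
    (hinj : Function.Injective u) : ∀ᵐ y ∂(μ.prod μ), u y.1 ≠ u y.2 := by
  rw [Measure.ae_prod_iff_ae_ae (isOpen_ne_fun (by fun_prop) (by fun_prop)).measurableSet]
  refine .of_forall fun t => ?_
  filter_upwards [μ.ae_ne t] with s hs
  exact hinj.ne hs.symm

theorem tendsto_one_sub_sq_div : Tendsto (fun ρ : ℝ => (1 - ρ) ^ 2 / ρ) (𝓝[<] 1) (𝓝[>] 0) := by
  refine tendsto_nhdsWithin_iff.2 ⟨?_, ?_⟩
  · have : ContinuousAt (fun ρ : ℝ => (1 - ρ) ^ 2 / ρ) 1 :=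
      ContinuousAt.div (by fun_prop) (by fun_prop) one_ne_zero
    simpa using this.tendsto.mono_left (nhdsWithin_le_nhds (s := Iio 1))
  · filter_upwards [Ioo_mem_nhdsLT one_pos] with ρ hρ
    exact div_pos (pow_pos (sub_pos.2 hρ.2) 2) hρ.1

section LogarithmicEnergy

variable {T : Type*} [TopologicalSpace T] [CompactSpace T] [SecondCountableTopology T]
  [MeasurableSpace T] [BorelSpace T] {μ : Measure T} [IsFiniteMeasure μ] {x : T → ℝ}

theorem integral_gram_pow_nonneg {ι : Type*} [Fintype ι] {v : ι → T → ℝ}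
    (hv : ∀ i, Continuous (v i)) (hx : Continuous x) (n : ℕ) :
    0 ≤ ∫ y, (∑ i, v i y.1 * v i y.2) ^ n * (x y.1 * x y.2) ∂(μ.prod μ) := by
  have expand (y : T × T) : (∑ i, v i y.1 * v i y.2) ^ n * (x y.1 * x y.2) =
      ∑ p : Fin n → ι, ((∏ j, v (p j) y.1) * x y.1) * ((∏ j, v (p j) y.2) * x y.2) := by
    rw [Fintype.sum_pow, Finset.sum_mul]
    refine Finset.sum_congr rfl fun p _ => ?_
    rw [Finset.prod_mul_distrib]
    ring
  simp_rw [expand]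
  rw [integral_finsetSum _ fun p _ => integrable_of_continuous (by fun_prop)]
  refine Finset.sum_nonneg fun p _ => ?_
  rw [integral_prod_mul (fun t => (∏ j, v (p j) t) * x t) (fun t => (∏ j, v (p j) t) * x t)]
  exact mul_self_nonneg _

theorem integral_neg_log_one_sub_gram_nonneg {ι : Type*} [Fintype ι] {v : ι → T → ℝ}
    (hv : ∀ i, Continuous (v i)) (hv1 : ∀ t s, |∑ i, v i t * v i s| < 1) (hx : Continuous x) :
    0 ≤ ∫ y, -Real.log (1 - ∑ i, v i y.1 * v i y.2) * (x y.1 * x y.2) ∂(μ.prod μ) := by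
  set k : T × T → ℝ := fun y => ∑ i, v i y.1 * v i y.2
  have hk : Continuous k := by fun_prop
  obtain ⟨a, ha0, ha1, hka⟩ := exists_abs_le_lt_one hk fun y => hv1 y.1 y.2
  have bound (n : ℕ) (y : T × T) : |k y ^ (n + 1) / ((n : ℝ) + 1)| ≤ a ^ n := by
    have hn : (1 : ℝ) ≤ |(n : ℝ) + 1| := by
      rw [abs_of_nonneg (by positivity)]
      exact le_add_of_nonneg_left n.cast_nonneg
    calc |k y ^ (n + 1) / ((n : ℝ) + 1)| ≤ |k y| ^ (n + 1) := by
          rw [abs_div, abs_pow]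
          exact div_le_self (by positivity) hn
      _ ≤ |k y| ^ n := pow_le_pow_of_le_one (abs_nonneg _) (hv1 _ _).le n.le_succ
      _ ≤ a ^ n := by gcongr; exact hka y
  refine (hasSum_integral_mul_of_geometric_bound (ν := μ.prod μ) (w := fun y => x y.1 * x y.2)
    (fun n => (hk.pow _).div_const _) (by fun_prop) ha0 ha1 bound
    fun y => Real.hasSum_pow_div_log_of_abs_lt_one (hv1 y.1 y.2)).nonneg fun n => ?_
  simp_rw [div_mul_eq_mul_div]
  rw [integral_div]
  exact div_nonneg (integral_gram_pow_nonneg hv hx (n + 1)) (by positivity)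

theorem integral_log_norm_sub_sq_add_nonpos {h : T → ℂ} (hh : Continuous h) (hx : Continuous x)
    (hx0 : ∫ t, x t ∂μ = 0) {ε : ℝ} (hε0 : 0 < ε) (hε : ε ≤ 1) :
    ∫ y, Real.log (‖h y.1 - h y.2‖ ^ 2 + ε) * (x y.1 * x y.2) ∂(μ.prod μ) ≤ 0 := by
  set l : T → ℝ := fun t => Real.log (1 + ‖h t‖ ^ 2)
  have hl : Continuous l := Continuous.log (by fun_prop) fun t => by positivity
  have hlog : Continuous fun y : T × T => Real.log (‖h y.1 - h y.2‖ ^ 2 + ε) :=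
    Continuous.log (by fun_prop) fun y => by positivity
  have split (y : T × T) :
      -Real.log (1 - ∑ i, sphereCoord ε (h y.1) i * sphereCoord ε (h y.2) i) * (x y.1 * x y.2) =
        (l y.1 * (x y.1 * x y.2) + l y.2 * (x y.1 * x y.2)) -
          Real.log (‖h y.1 - h y.2‖ ^ 2 + ε) * (x y.1 * x y.2) := by
    rw [one_sub_sum_sphereCoord hε, Real.log_div (by positivity) (by positivity),
      Real.log_mul (by positivity) (by positivity)]
    ring
  have nonneg := integral_neg_log_one_sub_gram_nonneg (μ := μ)
    (fun i => (continuous_sphereCoord ε i).comp hh)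
    (fun t s => abs_sum_sphereCoord_lt_one hε0 hε (h t) (h s)) hx
  simp only [Function.comp_apply, split] at nonneg
  rw [integral_sub (integrable_of_continuous (by fun_prop))
      (integrable_of_continuous (by fun_prop)),
    integral_add (integrable_of_continuous (by fun_prop))
      (integrable_of_continuous (by fun_prop)),
    integral_fst_mul_prod_eq_zero hx0, integral_snd_mul_prod_eq_zero hx0] at nonneg
  linarith

/-- The moment `∫ u ^ k x` of a charge `x` carried to the plane by `u`; for the circle
these are the Fourier coefficients of `x`. -/
noncomputable def moment (μ : Measure T) (u : T → ℂ) (x : T → ℂ) (k : ℕ) : ℂ :=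
  ∫ t, u t ^ k * x t ∂μ

theorem integral_re_mul_conj_pow {u : T → ℂ} (hu : Continuous u) (hx : Continuous x) (k : ℕ) :
    ∫ y, ((u y.1 * conj (u y.2)) ^ k).re * (x y.1 * x y.2) ∂(μ.prod μ) =
      ‖moment μ u (fun t => x t) k‖ ^ 2 := by
  have factor (y : T × T) : (u y.1 * conj (u y.2)) ^ k * ((x y.1 * x y.2 : ℝ) : ℂ) =
      (u y.1 ^ k * x y.1) * conj (u y.2 ^ k * x y.2) := by
    push_cast [map_mul, map_pow, Complex.conj_ofReal]
    ring
  have complex : ∫ y, (u y.1 * conj (u y.2)) ^ k * ((x y.1 * x y.2 : ℝ) : ℂ) ∂(μ.prod μ) =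
      ((‖moment μ u (fun t => x t) k‖ ^ 2 : ℝ) : ℂ) := by
    simp_rw [factor]
    rw [integral_prod_mul (fun t => u t ^ k * (x t : ℂ)) (fun t => conj (u t ^ k * (x t : ℂ))),
      integral_conj, ← moment, Complex.mul_conj, Complex.normSq_eq_norm_sq]
  simp_rw [← Complex.re_mul_ofReal]
  rw [← Complex.ofReal_re (‖_‖ ^ 2), ← complex]
  have hint : Integrable
      (fun y => (u y.1 * conj (u y.2)) ^ k * ((x y.1 * x y.2 : ℝ) : ℂ)) (μ.prod μ) :=
    integrable_of_continuous (by fun_prop)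
  exact integral_re hint

theorem hasSum_circle_log_energy {u : T → ℂ} (hu : Continuous u) (hu1 : ∀ t, ‖u t‖ = 1)
    (hx : Continuous x) (hx0 : ∫ t, x t ∂μ = 0) {ρ : ℝ} (hρ0 : 0 < ρ) (hρ1 : ρ < 1) :
    HasSum (fun k : ℕ => 2 * (ρ ^ k * (‖moment μ u (fun t => x t) k‖ ^ 2 / k)))
      (-∫ y, Real.log (‖u y.1 - u y.2‖ ^ 2 + (1 - ρ) ^ 2 / ρ) * (x y.1 * x y.2) ∂(μ.prod μ)) := by
  set ζ : T × T → ℂ := fun y => ρ * (u y.1 * conj (u y.2))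
  have hζ : Continuous ζ := by fun_prop
  have norm_ζ (y : T × T) : ‖ζ y‖ = ρ := by simp [ζ, hu1, abs_of_pos hρ0]
  have one_sub_ζ (y : T × T) : ‖1 - ζ y‖ ≠ 0 := by
    rw [norm_ne_zero_iff, sub_ne_zero]
    rintro h
    exact hρ1.ne (by rw [← norm_ζ y, ← h, norm_one])
  have bound (n : ℕ) (y : T × T) : |(ζ y ^ n).re / n| ≤ ρ ^ n := by
    rcases n.eq_zero_or_pos with rfl | hn
    · simp
    · calc |(ζ y ^ n).re / n| ≤ |(ζ y ^ n).re| := by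
            rw [abs_div, Nat.abs_cast]
            exact div_le_self (abs_nonneg _) (Nat.one_le_cast.2 hn)
        _ ≤ ρ ^ n := by simpa only [norm_pow, norm_ζ] using Complex.abs_re_le_norm (ζ y ^ n)
  have series := hasSum_integral_mul_of_geometric_bound (ν := μ.prod μ)
    (w := fun y => x y.1 * x y.2) (fun n => by fun_prop) (by fun_prop) hρ0.le hρ1 bound
    fun y => hasSum_neg_log_norm_one_sub ((norm_ζ y).trans_lt hρ1)
  have term (n : ℕ) : ∫ y, (ζ y ^ n).re / n * (x y.1 * x y.2) ∂(μ.prod μ) =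
      ρ ^ n * (‖moment μ u (fun t => x t) n‖ ^ 2 / n) := by
    rw [← integral_re_mul_conj_pow hu hx, ← integral_div, ← integral_const_mul]
    refine integral_congr_ae (.of_forall fun y => ?_)
    simp only [ζ, mul_pow, ← Complex.ofReal_pow, Complex.re_ofReal_mul]
    ring
  have log_eq (y : T × T) :
      Real.log (‖u y.1 - u y.2‖ ^ 2 + (1 - ρ) ^ 2 / ρ) * (x y.1 * x y.2) =
        (-2) * (-Real.log ‖1 - ζ y‖ * (x y.1 * x y.2)) - Real.log ρ * (x y.1 * x y.2) := by
    rw [norm_sub_sq_add_eq (hu1 _) (hu1 _) hρ0, Real.log_div (pow_ne_zero 2 (one_sub_ζ y)) hρ0.ne',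
      Real.log_pow]
    push_cast
    ring
  have : Continuous fun y => Real.log ‖1 - ζ y‖ := Continuous.log (by fun_prop) one_sub_ζ
  simp_rw [log_eq]
  rw [integral_sub (integrable_of_continuous (by fun_prop))
      (integrable_of_continuous (by fun_prop)),
    integral_fst_mul_prod_eq_zero hx0 (fun _ => Real.log ρ), integral_const_mul, sub_zero,
    neg_mul, neg_neg]
  simpa only [term] using series.mul_left 2

/-- Here `‖u y.1 - u y.2‖ ^ 2 * exp (2 * Φ y)` stands for the squared chord of a second curve, so
the integrand compares the regularized logarithmic kernels of the two curves. -/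
theorem tendsto_integral_log_sub_log [NullSingletonClass μ] {u : T → ℂ} (hu : Continuous u)
    (hinj : Function.Injective u) {Φ : T × T → ℝ} (hΦ : Continuous Φ) (hx : Continuous x) :
    Tendsto (fun ε => ∫ y, (Real.log (‖u y.1 - u y.2‖ ^ 2 * Real.exp (2 * Φ y) + ε) -
        Real.log (‖u y.1 - u y.2‖ ^ 2 + ε)) * (x y.1 * x y.2) ∂(μ.prod μ))
      (𝓝[>] 0) (𝓝 (∫ y, 2 * Φ y * (x y.1 * x y.2) ∂(μ.prod μ))) := by
  refine tendsto_integral_filter_of_dominated_convergence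
    (fun y => |2 * Φ y| * ‖x y.1 * x y.2‖) ?_ ?_ (integrable_of_continuous (by fun_prop)) ?_
  · filter_upwards [self_mem_nhdsWithin] with ε (hε : 0 < ε)
    have h1 : Continuous fun y : T × T =>
        Real.log (‖u y.1 - u y.2‖ ^ 2 * Real.exp (2 * Φ y) + ε) :=
      Continuous.log (by fun_prop) fun y => by positivity
    have h2 : Continuous fun y : T × T => Real.log (‖u y.1 - u y.2‖ ^ 2 + ε) :=
      Continuous.log (by fun_prop) fun y => by positivity
    exact Continuous.aestronglyMeasurable (by fun_prop)
  · filter_upwards [self_mem_nhdsWithin] with ε (hε : 0 < ε)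
    refine .of_forall fun y => ?_
    rw [norm_mul]
    gcongr
    exact abs_log_mul_exp_add_sub_log_add_le (by positivity) hε
  · filter_upwards [ae_prod_ne_of_injective (μ := μ) hu hinj] with y hy
    have hτ : 0 < ‖u y.1 - u y.2‖ ^ 2 := pow_pos (norm_pos_iff.2 (sub_ne_zero.2 hy)) 2
    have hτΦ : 0 < ‖u y.1 - u y.2‖ ^ 2 * Real.exp (2 * Φ y) := by positivity
    have hlim (c : ℝ) (hc : 0 < c) :
        Tendsto (fun ε => Real.log (c + ε)) (𝓝[>] 0) (𝓝 (Real.log c)) := by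
      have : ContinuousAt (fun ε => Real.log (c + ε)) 0 :=
        ContinuousAt.log (by fun_prop) (by simpa using hc.ne')
      simpa using this.tendsto.mono_left nhdsWithin_le_nhds
    have := (hlim _ hτΦ).sub (hlim _ hτ)
    rw [Real.log_mul hτ.ne' (Real.exp_pos _).ne', Real.log_exp, add_sub_cancel_left] at this
    exact this.mul_const _

theorem integral_distortion_le [NullSingletonClass μ] {h u : T → ℂ} (hh : Continuous h)
    (hu : Continuous u) (hu1 : ∀ t, ‖u t‖ = 1) (hinj : Function.Injective u) {Φ : T × T → ℝ}
    (hΦ : Continuous Φ)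
    (hdist : ∀ t s, ‖h t - h s‖ ^ 2 = ‖u t - u s‖ ^ 2 * Real.exp (2 * Φ (t, s)))
    (hx : Continuous x) (hx0 : ∫ t, x t ∂μ = 0)
    (hs : Summable fun k : ℕ => ‖moment μ u (fun t => x t) k‖ ^ 2 / k) :
    ∫ y, Φ y * (x y.1 * x y.2) ∂(μ.prod μ) ≤
      ∑' k : ℕ, ‖moment μ u (fun t => x t) k‖ ^ 2 / k := by
  have hlim := (tendsto_integral_log_sub_log (μ := μ) hu hinj hΦ hx).comp tendsto_one_sub_sq_div
  have hsmall : ∀ᶠ ρ in 𝓝[<] (1 : ℝ), (1 - ρ) ^ 2 / ρ ∈ Ioc 0 1 :=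
    tendsto_one_sub_sq_div (Ioc_mem_nhdsGT one_pos)
  have hle := le_of_tendsto (b := 2 * ∑' k : ℕ, ‖moment μ u (fun t => x t) k‖ ^ 2 / k) hlim <| by
    filter_upwards [Ioo_mem_nhdsLT one_pos, hsmall] with ρ hρ hε
    have energy_h := integral_log_norm_sub_sq_add_nonpos (μ := μ) hh hx hx0 hε.1 hε.2
    have energy_u := hasSum_circle_log_energy hu hu1 hx hx0 hρ.1 hρ.2
    have damping (k : ℕ) : 2 * (ρ ^ k * (‖moment μ u (fun t => x t) k‖ ^ 2 / k)) ≤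
        2 * (‖moment μ u (fun t => x t) k‖ ^ 2 / k) := by
      gcongr
      exact mul_le_of_le_one_left (by positivity) (pow_le_one₀ hρ.1.le hρ.2.le)
    have energy_u_le := energy_u.tsum_eq ▸ energy_u.summable.tsum_le_tsum damping (hs.mul_left 2)
    have h1 : Continuous fun y : T × T => Real.log (‖h y.1 - h y.2‖ ^ 2 + (1 - ρ) ^ 2 / ρ) :=
      Continuous.log (by fun_prop) fun y => by have := hε.1; positivity
    have h2 : Continuous fun y : T × T => Real.log (‖u y.1 - u y.2‖ ^ 2 + (1 - ρ) ^ 2 / ρ) :=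
      Continuous.log (by fun_prop) fun y => by have := hε.1; positivity
    rw [tsum_mul_left] at energy_u_le
    simp only [Function.comp_apply, ← hdist, sub_mul]
    rw [integral_sub (integrable_of_continuous (by fun_prop))
      (integrable_of_continuous (by fun_prop))]
    linarith
  simp_rw [mul_assoc] at hle
  rw [integral_const_mul] at hle
  linarith

end LogarithmicEnergy

section CauchyKernel

/-- The parametrization `t ↦ r * exp (2πit)` of the circle of radius `r` by `ℝ / ℤ`, which carries
the normalized arc length. -/
noncomputable def circlePoint (r : ℝ) (t : UnitAddCircle) : ℂ := r * (t.toCircle : ℂ)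

instance : NullSingletonClass (volume : Measure UnitAddCircle) where
  measure_singleton t := by
    rw [← Metric.closedBall_zero, AddCircle.volume_closedBall]
    simp

@[fun_prop]
theorem continuous_circlePoint (r : ℝ) : Continuous (circlePoint r) := by
  unfold circlePoint
  fun_prop

theorem norm_circlePoint {r : ℝ} (hr : 0 < r) (t : UnitAddCircle) : ‖circlePoint r t‖ = r := by
  rw [circlePoint, norm_mul, Circle.norm_coe, mul_one, Complex.norm_of_nonneg hr.le]

theorem circlePoint_ne_zero {r : ℝ} (hr : 0 < r) (t : UnitAddCircle) : circlePoint r t ≠ 0 :=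
  norm_ne_zero_iff.1 (by rw [norm_circlePoint hr t]; exact hr.ne')

theorem conj_circlePoint {r : ℝ} (hr : 0 < r) (t : UnitAddCircle) :
    conj (circlePoint r t) = r ^ 2 / circlePoint r t := by
  rw [eq_div_iff (circlePoint_ne_zero hr t), Complex.conj_mul', norm_circlePoint hr]

theorem circlePoint_sub_ne_zero {r : ℝ} {z : ℂ} (hz : z ∈ Metric.ball 0 r) (t : UnitAddCircle) :
    circlePoint r t - z ≠ 0 := by
  rw [mem_ball_zero_iff] at hz
  refine sub_ne_zero.2 fun h => hz.ne ?_
  rw [← h, norm_circlePoint ((norm_nonneg z).trans_lt hz)]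

theorem integral_comp_circlePoint (r : ℝ) (g : ℂ → ℂ) :
    ∫ t, g (circlePoint r t) = Real.circleAverage g 0 r := by
  rw [← UnitAddCircle.intervalIntegral_preimage 0, zero_add, Real.circleAverage_def]
  have h := intervalIntegral.smul_integral_comp_mul_right (a := 0) (b := 1)
    (fun θ => g (circleMap 0 r θ)) (2 * Real.pi)
  rw [zero_mul, one_mul] at h
  rw [← h, inv_smul_smul₀ Real.two_pi_pos.ne']
  refine intervalIntegral.integral_congr fun t _ => ?_
  simp [circlePoint, AddCircle.toCircle_apply_mk, circleMap, Circle.coe_exp, mul_comm]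

/-- The kernel of the `p`-th derivative in Cauchy's formula on the circle of radius `r`, with
respect to normalized arc length. -/
noncomputable def cauchyKernel (p : ℕ) (r : ℝ) (z : ℂ) (t : UnitAddCircle) : ℂ :=
  p.factorial * circlePoint r t * ((circlePoint r t - z) ^ (p + 1))⁻¹

theorem continuousOn_cauchyKernel (p : ℕ) (r : ℝ) :
    ContinuousOn (fun y : ℂ × UnitAddCircle => cauchyKernel p r y.1 y.2)
      (Metric.ball 0 r ×ˢ univ) := by
  unfold cauchyKernel
  refine ContinuousOn.mul (by fun_prop) (ContinuousOn.inv₀ (by fun_prop) fun y hy => ?_)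
  exact pow_ne_zero _ (circlePoint_sub_ne_zero hy.1 _)

theorem continuous_cauchyKernel (p : ℕ) {r : ℝ} {z : ℂ} (hz : z ∈ Metric.ball 0 r) :
    Continuous (cauchyKernel p r z) :=
  (continuousOn_cauchyKernel p r).comp_continuous (f := fun t => (z, t)) (by fun_prop)
    fun t => ⟨hz, mem_univ t⟩

theorem hasDerivAt_cauchyKernel (p : ℕ) {r : ℝ} (t : UnitAddCircle) {z : ℂ}
    (hz : z ∈ Metric.ball 0 r) :
    HasDerivAt (fun z => cauchyKernel p r z t) (cauchyKernel (p + 1) r z t) z := by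
  have hne := circlePoint_sub_ne_zero hz t
  have h := ((((hasDerivAt_id z).const_sub (circlePoint r t)).pow (p + 1)).inv
    (pow_ne_zero _ hne)).const_mul (p.factorial * circlePoint r t)
  refine h.congr_deriv ?_
  simp only [cauchyKernel, Pi.pow_apply, id_eq, Nat.factorial_succ, Nat.cast_mul,
    Nat.add_sub_cancel]
  field_simp
  ring

theorem iteratedDeriv_integral_mul_cauchyKernel {g : UnitAddCircle → ℂ} (hg : Integrable g)
    (p : ℕ) {r : ℝ} {z : ℂ} (hz : z ∈ Metric.ball 0 r) :
    iteratedDeriv p (fun z => ∫ t, g t * cauchyKernel 0 r z t) z =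
      ∫ t, g t * cauchyKernel p r z t := by
  induction p generalizing z with
  | zero => rw [iteratedDeriv_zero]
  | succ p ih =>
    have heq : iteratedDeriv p (fun z => ∫ t, g t * cauchyKernel 0 r z t) =ᶠ[𝓝 z]
        fun z => ∫ t, g t * cauchyKernel p r z t :=
      eventually_of_mem (Metric.isOpen_ball.mem_nhds hz) fun z hz => ih hz
    rw [iteratedDeriv_succ, heq.deriv_eq]
    exact (hasDerivAt_integral_mul Metric.isOpen_ball (fun z => continuous_cauchyKernel p)
      (continuousOn_cauchyKernel (p + 1) r) (fun t z => hasDerivAt_cauchyKernel p t) hg hz).deriv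

theorem circlePoint_mem_unitDisk {r : ℝ} (hr : 0 < r) (hr1 : r < 1) (t : UnitAddCircle) :
    circlePoint r t ∈ unitDisk :=
  mem_ball_zero_iff.2 ((norm_circlePoint hr t).trans_lt hr1)

theorem continuous_comp_circlePoint {g : ℂ → ℂ} (hg : ContinuousOn g unitDisk) {r : ℝ}
    (hr : 0 < r) (hr1 : r < 1) : Continuous fun t => g (circlePoint r t) :=
  hg.comp_continuous (continuous_circlePoint r) (circlePoint_mem_unitDisk hr hr1)

theorem diffContOnCl_ball_of_unitDisk {g : ℂ → ℂ} (hg : DifferentiableOn ℂ g unitDisk) {r : ℝ}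
    (hr : 0 < r) (hr1 : r < 1) : DiffContOnCl ℂ g (Metric.ball 0 |r|) := by
  rw [abs_of_pos hr]
  exact (hg.mono (Metric.closure_ball_subset_closedBall.trans
    (Metric.closedBall_subset_ball hr1))).diffContOnCl

theorem integral_mul_cauchyKernel_zero {g : ℂ → ℂ} (hg : DifferentiableOn ℂ g unitDisk) {r : ℝ}
    (hr1 : r < 1) {z : ℂ} (hz : z ∈ Metric.ball 0 r) :
    ∫ t, g (circlePoint r t) * cauchyKernel 0 r z t = g z := by
  have hr : 0 < r := Metric.pos_of_mem_ball hz
  rw [← (diffContOnCl_ball_of_unitDisk hg hr hr1).circleAverage_smul_div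
    (by rwa [abs_of_pos hr]), ← integral_comp_circlePoint]
  congr 1 with t
  simp only [cauchyKernel, Nat.factorial_zero, Nat.cast_one, zero_add, pow_one, sub_zero,
    smul_eq_mul, one_mul, div_eq_mul_inv]
  ring

theorem integral_mul_cauchyKernel {g : ℂ → ℂ} (hg : DifferentiableOn ℂ g unitDisk) {r : ℝ}
    (hr1 : r < 1) {z : ℂ} (hz : z ∈ Metric.ball 0 r) (p : ℕ) :
    ∫ t, g (circlePoint r t) * cauchyKernel p r z t = iteratedDeriv p g z := by
  have hr : 0 < r := Metric.pos_of_mem_ball hz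
  have hgc := continuous_comp_circlePoint hg.continuousOn hr hr1
  rw [← iteratedDeriv_integral_mul_cauchyKernel (integrable_of_continuous hgc) p hz]
  refine Filter.EventuallyEq.iteratedDeriv_eq p ?_
  filter_upwards [Metric.isOpen_ball.mem_nhds hz] with ζ hζ
    using integral_mul_cauchyKernel_zero hg hr1 hζ

end CauchyKernel

section HardyCharge

/-- A charge on the circle of radius `r` all of whose frequencies are negative: its conjugate is
the boundary value of a holomorphic function vanishing at the origin, and so is orthogonal to
every holomorphic function. -/
structure IsHardyCharge (r : ℝ) (X : UnitAddCircle → ℂ) : Prop where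
  continuous : Continuous X
  annihilates : ∀ g : ℂ → ℂ, DifferentiableOn ℂ g unitDisk →
    ∫ t, g (circlePoint r t) * conj (X t) = 0

theorem isHardyCharge_cauchyKernel {p : ℕ} (hp : 1 ≤ p) {r : ℝ} (hr1 : r < 1) {z : ℂ}
    (hz : z ∈ Metric.ball 0 r) : IsHardyCharge r (cauchyKernel p r z) where
  continuous := continuous_cauchyKernel p hz
  annihilates g hg := by
    have hr : 0 < r := Metric.pos_of_mem_ball hz
    have hne : ∀ w ∈ Metric.closedBall (0 : ℂ) r, (r : ℂ) ^ 2 - conj z * w ≠ 0 := by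
      intro w hw h
      have h1 : ‖conj z * w‖ = r ^ 2 := by
        rw [← sub_eq_zero.1 h, ← Complex.ofReal_pow, Complex.norm_of_nonneg (by positivity)]
      rw [mem_ball_zero_iff] at hz
      rw [mem_closedBall_zero_iff] at hw
      rw [norm_mul, RCLike.norm_conj] at h1
      nlinarith [norm_nonneg z]
    -- On the circle, `conj ζ = r ^ 2 / ζ`.
    let G : ℂ → ℂ := fun w =>
      g w * (p.factorial * r ^ 2 * w ^ p * (((r : ℂ) ^ 2 - conj z * w) ^ (p + 1))⁻¹)
    have hG : DiffContOnCl ℂ G (Metric.ball 0 |r|) := by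
      rw [abs_of_pos hr]
      refine DifferentiableOn.diffContOnCl (DifferentiableOn.mono ?_
        Metric.closure_ball_subset_closedBall)
      refine (hg.mono (Metric.closedBall_subset_ball hr1)).mul
        (DifferentiableOn.mul (by fun_prop) (DifferentiableOn.inv (by fun_prop) fun w hw => ?_))
      exact pow_ne_zero _ (hne w hw)
    have hpt : ∀ t, g (circlePoint r t) * conj (cauchyKernel p r z t) = G (circlePoint r t) := by
      intro t
      have hζ := circlePoint_ne_zero hr t
      have := hne (circlePoint r t) (by simp [norm_circlePoint hr])
      have hsub : (r : ℂ) ^ 2 / circlePoint r t - conj z =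
          (r ^ 2 - conj z * circlePoint r t) / circlePoint r t := by
        field_simp
      simp only [G, cauchyKernel, map_mul, map_inv₀, map_pow, map_sub, map_natCast,
        conj_circlePoint hr, hsub, div_pow, inv_div]
      field_simp
      ring
    simp_rw [hpt]
    rw [integral_comp_circlePoint, hG.circleAverage]
    simp [G, Nat.one_le_iff_ne_zero.1 hp]

theorem IsHardyCharge.const_mul {r : ℝ} {X : UnitAddCircle → ℂ} (hX : IsHardyCharge r X) (c : ℂ) :
    IsHardyCharge r fun t => c * X t where
  continuous := hX.continuous.const_mul c
  annihilates g hg := by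
    simp_rw [map_mul, mul_left_comm _ (conj c)]
    rw [integral_const_mul, hX.annihilates g hg, mul_zero]

theorem IsHardyCharge.add {r : ℝ} (hr : 0 < r) (hr1 : r < 1) {X Y : UnitAddCircle → ℂ}
    (hX : IsHardyCharge r X) (hY : IsHardyCharge r Y) : IsHardyCharge r fun t => X t + Y t where
  continuous := hX.continuous.add hY.continuous
  annihilates g hg := by
    have hgc := continuous_comp_circlePoint hg.continuousOn hr hr1
    have hXc : Continuous fun t => conj (X t) := Complex.continuous_conj.comp hX.continuous
    have hYc : Continuous fun t => conj (Y t) := Complex.continuous_conj.comp hY.continuous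
    simp_rw [map_add, mul_add]
    rw [integral_add (integrable_of_continuous (hgc.fun_mul hXc))
      (integrable_of_continuous (hgc.fun_mul hYc)), hX.annihilates g hg,
      hY.annihilates g hg, add_zero]

theorem IsHardyCharge.integral_two_mul_re {r : ℝ} {X : UnitAddCircle → ℂ}
    (hX : IsHardyCharge r X) : ∫ t, 2 * (X t).re = 0 := by
  have h := hX.annihilates (fun _ => 1) (differentiableOn_const _)
  simp only [one_mul] at h
  rw [integral_conj, map_eq_zero] at h
  have hre := integral_re (𝕜 := ℂ) (integrable_of_continuous (ν := volume) hX.continuous)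
  simp only [RCLike.re_eq_complex_re] at hre
  rw [integral_const_mul, hre, h, Complex.zero_re, mul_zero]

/-- The `k`-th Fourier coefficient of the charge `X`, weighted so that the sum of the squared moduli
is the logarithmic energy of `X`. At `k = 0` the division by zero makes it vanish. -/
noncomputable def energyCoeff (X : UnitAddCircle → ℂ) (k : ℕ) : ℂ :=
  moment volume (fun t => (t.toCircle : ℂ)) X k / √k

theorem norm_energyCoeff_sq (X : UnitAddCircle → ℂ) (k : ℕ) :
    ‖energyCoeff X k‖ ^ 2 = ‖moment volume (fun t => (t.toCircle : ℂ)) X k‖ ^ 2 / k := by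
  rw [energyCoeff, norm_div, div_pow, Complex.norm_of_nonneg (Real.sqrt_nonneg _),
    Real.sq_sqrt k.cast_nonneg]

theorem energyCoeff_add_mul {X Y : UnitAddCircle → ℂ} (hX : Continuous X) (hY : Continuous Y)
    (a b : ℂ) (k : ℕ) :
    energyCoeff (fun t => a * X t + b * Y t) k = a * energyCoeff X k + b * energyCoeff Y k := by
  have h : moment volume (fun t => (t.toCircle : ℂ)) (fun t => a * X t + b * Y t) k =
      a * moment volume (fun t => (t.toCircle : ℂ)) X k +
        b * moment volume (fun t => (t.toCircle : ℂ)) Y k := by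
    simp only [moment, mul_add, mul_left_comm _ a, mul_left_comm _ b]
    rw [integral_add (integrable_of_continuous (by fun_prop))
      (integrable_of_continuous (by fun_prop)), integral_const_mul, integral_const_mul]
  rw [energyCoeff, h]
  simp only [energyCoeff]
  ring

theorem IsHardyCharge.moment_two_mul_re {r : ℝ} (hr : 0 < r) {X : UnitAddCircle → ℂ}
    (hX : IsHardyCharge r X) (k : ℕ) :
    moment volume (fun t => (t.toCircle : ℂ)) (fun t => ((2 * (X t).re : ℝ) : ℂ)) k =
      moment volume (fun t => (t.toCircle : ℂ)) X k := by
  have hr0 : (r : ℂ) ≠ 0 := Complex.ofReal_ne_zero.2 hr.ne'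
  have hXc := hX.continuous
  have h := hX.annihilates (fun w => ((r : ℂ)⁻¹ * w) ^ k) (by fun_prop)
  simp only [circlePoint, inv_mul_cancel_left₀ hr0] at h
  simp only [moment, ← Complex.add_conj, mul_add]
  rw [integral_add (integrable_of_continuous (by fun_prop))
    (integrable_of_continuous (by fun_prop)), h, add_zero]

theorem moment_cauchyKernel {r : ℝ} (hr1 : r < 1) {z : ℂ} (hz : z ∈ Metric.ball 0 r) (p k : ℕ) :
    moment volume (fun t => (t.toCircle : ℂ)) (cauchyKernel p r z) k =
      (r : ℂ)⁻¹ ^ k * (k.descFactorial p * z ^ (k - p)) := by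
  have hr0 : (r : ℂ) ≠ 0 := Complex.ofReal_ne_zero.2 (Metric.pos_of_mem_ball hz).ne'
  rw [← iteratedDeriv_pow, ← iteratedDeriv_const_mul_field,
    ← integral_mul_cauchyKernel (by fun_prop) hr1 hz p, moment]
  congr 1 with t
  rw [← mul_pow, circlePoint, inv_mul_cancel_left₀ hr0]

theorem descFactorial_sq_le (n k : ℕ) :
    k.descFactorial (n + 1) ^ 2 ≤
      k * ((2 * n + 1).factorial * (k + n).choose (2 * n + 1)) := by
  obtain hk | ⟨m, rfl⟩ := (lt_or_ge k (n + 1)).imp_right Nat.exists_eq_add_of_le'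
  · rw [Nat.descFactorial_of_lt hk, zero_pow two_ne_zero]
    exact Nat.zero_le _
  rw [show m + (n + 1) + n = m + (2 * n + 1) by ring, Nat.add_descFactorial_eq_ascFactorial,
    ← Nat.ascFactorial_eq_factorial_mul_choose, show 2 * n + 1 = (n + 1) + n by ring,
    ← Nat.ascFactorial_mul_ascFactorial (m + 1) (n + 1) n]
  calc (m + 1).ascFactorial (n + 1) ^ 2
      = (m + (n + 1)) * ((m + 1).ascFactorial (n + 1) * (m + 1).ascFactorial n) := by
        rw [sq]
        nth_rewrite 2 [Nat.ascFactorial_succ]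
        ring
    _ ≤ (m + (n + 1)) *
        ((m + 1).ascFactorial (n + 1) * (m + 1 + (n + 1)).ascFactorial n) :=
        Nat.mul_le_mul_left _ (Nat.mul_le_mul_left _
          (Nat.ascFactorial_le n (Nat.le_add_right (m + 1) (n + 1))))

theorem norm_energyCoeff_cauchyKernel_sq_le (n : ℕ) {r : ℝ} (hr1 : r < 1) {z : ℂ}
    (hz : z ∈ Metric.ball 0 r) (k : ℕ) :
    ‖energyCoeff (cauchyKernel (n + 1) r z) k‖ ^ 2 ≤ (2 * n + 1).factorial * r⁻¹ ^ (2 * (n + 1)) *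
      (((k + n).choose (2 * n + 1) : ℝ) * ((‖z‖ / r) ^ 2) ^ (k - (n + 1))) := by
  have hr : 0 < r := Metric.pos_of_mem_ball hz
  rw [norm_energyCoeff_sq, moment_cauchyKernel hr1 hz]
  obtain hk | ⟨m, rfl⟩ := (lt_or_ge k (n + 1)).imp_right Nat.exists_eq_add_of_le'
  · rw [Nat.descFactorial_of_lt hk, Nat.cast_zero, zero_mul, mul_zero, norm_zero,
      zero_pow two_ne_zero, zero_div]
    positivity
  have hd : ((m + (n + 1)).descFactorial (n + 1) : ℝ) ^ 2 ≤ ((m + (n + 1) : ℕ) : ℝ) *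
      ((2 * n + 1).factorial * ((m + (n + 1) + n).choose (2 * n + 1) : ℝ)) := by
    exact_mod_cast descFactorial_sq_le n (m + (n + 1))
  simp only [norm_mul, norm_pow, norm_inv, Complex.norm_natCast, Complex.norm_of_nonneg hr.le,
    Nat.add_sub_cancel]
  rw [div_le_iff₀ (by positivity)]
  calc (r⁻¹ ^ (m + (n + 1)) * (((m + (n + 1)).descFactorial (n + 1) : ℝ) * ‖z‖ ^ m)) ^ 2
      = ((m + (n + 1)).descFactorial (n + 1) : ℝ) ^ 2 *
          (r⁻¹ ^ (2 * (n + 1)) * ((‖z‖ / r) ^ 2) ^ m) := by ring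
    _ ≤ _ := mul_le_mul_of_nonneg_right hd (by positivity)
    _ = _ := by ring

theorem hasSum_choose_mul_geometric_shift (n : ℕ) {x : ℝ} (hx : ‖x‖ < 1) :
    HasSum (fun k : ℕ => ((k + n).choose (2 * n + 1) : ℝ) * x ^ (k - (n + 1)))
      (1 / (1 - x) ^ (2 * (n + 1))) := by
  refine ((add_left_injective (n + 1)).hasSum_iff fun k hk => ?_).1 ?_
  · have hlt : k < n + 1 := by
      by_contra! h
      exact hk ⟨k - (n + 1), Nat.sub_add_cancel h⟩
    rw [Nat.choose_eq_zero_of_lt (by omega), Nat.cast_zero, zero_mul]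
  · have hidx : ∀ m, m + (n + 1) + n = m + (2 * n + 1) := fun m => by ring
    simp only [Function.comp_def, Nat.add_sub_cancel, hidx]
    exact hasSum_choose_mul_geometric_of_norm_lt_one (2 * n + 1) hx

theorem exists_lp_of_norm_sq_le {c : ℕ → ℂ} {b : ℕ → ℝ} {S : ℝ} (hb : HasSum b S)
    (hc : ∀ k, ‖c k‖ ^ 2 ≤ b k) : ∃ v : lp (fun _ : ℕ => ℂ) 2, ⇑v = c ∧ ‖v‖ ^ 2 ≤ S := by
  have hsum : Summable fun k => ‖c k‖ ^ 2 :=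
    hb.summable.of_nonneg_of_le (fun k => by positivity) hc
  have hmem : Memℓp c 2 := memℓp_gen (by simpa using hsum)
  refine ⟨⟨c, hmem⟩, rfl, ?_⟩
  have hnorm := lp.hasSum_norm (by simp) (⟨c, hmem⟩ : lp (fun _ : ℕ => ℂ) 2)
  simp only [ENNReal.toReal_ofNat, Real.rpow_ofNat] at hnorm
  exact hasSum_le hc hnorm hb

theorem exists_lp_energyCoeff_cauchyKernel {p : ℕ} (hp : 1 ≤ p) {r : ℝ} (hr1 : r < 1) {z : ℂ}
    (hz : z ∈ Metric.ball 0 r) :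
    ∃ v : lp (fun _ : ℕ => ℂ) 2, ⇑v = energyCoeff (cauchyKernel p r z) ∧
      ‖v‖ ≤ √(2 * p - 1).factorial * (r / (r ^ 2 - ‖z‖ ^ 2)) ^ p := by
  have hr : 0 < r := Metric.pos_of_mem_ball hz
  rw [mem_ball_zero_iff] at hz
  obtain ⟨n, rfl⟩ := Nat.exists_eq_add_of_le' hp
  have hsq : 0 < r ^ 2 - ‖z‖ ^ 2 := by nlinarith [norm_nonneg z]
  have hx : ‖(‖z‖ / r) ^ 2‖ < 1 := by
    rw [Real.norm_of_nonneg (by positivity), div_pow, div_lt_one (by positivity)]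
    linarith
  obtain ⟨v, hv, hle⟩ := exists_lp_of_norm_sq_le ((hasSum_choose_mul_geometric_shift n hx).mul_left
    ((2 * n + 1).factorial * r⁻¹ ^ (2 * (n + 1))))
    (norm_energyCoeff_cauchyKernel_sq_le n hr1 (mem_ball_zero_iff.2 hz))
  refine ⟨v, hv, le_of_sq_le_sq (hle.trans_eq ?_) (by positivity)⟩
  have hbase : r / (r ^ 2 - ‖z‖ ^ 2) = r⁻¹ * (1 / (1 - (‖z‖ / r) ^ 2)) := by
    field_simp
  rw [hbase, mul_pow _ _ 2, Real.sq_sqrt (by positivity), ← pow_mul, mul_pow, one_div_pow,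
    mul_comm (n + 1) 2, mul_assoc, show 2 * (n + 1) - 1 = 2 * n + 1 by omega]

end HardyCharge

section TorusPairing

variable {F : ℂ × ℂ → ℂ} {r : ℝ}

theorem differentiableOn_fst_of_bidisk (hF : DifferentiableOn ℂ F (unitDisk ×ˢ unitDisk)) {w : ℂ}
    (hw : w ∈ unitDisk) : DifferentiableOn ℂ (fun z => F (z, w)) unitDisk :=
  hF.comp (by fun_prop) fun _ hz => ⟨hz, hw⟩

theorem differentiableOn_snd_of_bidisk (hF : DifferentiableOn ℂ F (unitDisk ×ˢ unitDisk)) {z : ℂ}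
    (hz : z ∈ unitDisk) : DifferentiableOn ℂ (fun w => F (z, w)) unitDisk :=
  hF.comp (by fun_prop) fun _ hw => ⟨hz, hw⟩

theorem continuous_comp_torus (hF : ContinuousOn F (unitDisk ×ˢ unitDisk)) (hr : 0 < r)
    (hr1 : r < 1) :
    Continuous fun y : UnitAddCircle × UnitAddCircle => F (circlePoint r y.1, circlePoint r y.2) :=
  hF.comp_continuous (by fun_prop) fun y =>
    ⟨circlePoint_mem_unitDisk hr hr1 y.1, circlePoint_mem_unitDisk hr hr1 y.2⟩

theorem integrable_torusPairing (hF : ContinuousOn F (unitDisk ×ˢ unitDisk)) (hr : 0 < r)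
    (hr1 : r < 1) {X Y : UnitAddCircle → ℂ} (hX : Continuous X) (hY : Continuous Y) :
    Integrable (fun y : UnitAddCircle × UnitAddCircle =>
      F (circlePoint r y.1, circlePoint r y.2) * (X y.1 * Y y.2)) (volume.prod volume) :=
  integrable_of_continuous ((continuous_comp_torus hF hr hr1).mul (by fun_prop))

/-- The pairing of a function on the torus of radius `r` with two charges on the circle. -/
noncomputable def torusPairing (F : ℂ × ℂ → ℂ) (r : ℝ) (X Y : UnitAddCircle → ℂ) : ℂ :=
  ∫ y, F (circlePoint r y.1, circlePoint r y.2) * (X y.1 * Y y.2) ∂(volume.prod volume)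

theorem torusPairing_eq_integral_integral (hF : ContinuousOn F (unitDisk ×ˢ unitDisk))
    (hr : 0 < r) (hr1 : r < 1) {X Y : UnitAddCircle → ℂ} (hX : Continuous X) (hY : Continuous Y) :
    torusPairing F r X Y =
      ∫ t, (∫ s, F (circlePoint r t, circlePoint r s) * Y s) * X t := by
  rw [torusPairing, integral_prod _ (integrable_torusPairing hF hr hr1 hX hY)]
  congr 1 with t
  rw [← integral_mul_const]
  congr 1 with s
  ring

theorem torusPairing_eq_integral_integral_symm (hF : ContinuousOn F (unitDisk ×ˢ unitDisk))
    (hr : 0 < r) (hr1 : r < 1) {X Y : UnitAddCircle → ℂ} (hX : Continuous X) (hY : Continuous Y) :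
    torusPairing F r X Y =
      ∫ s, (∫ t, F (circlePoint r t, circlePoint r s) * X t) * Y s := by
  rw [torusPairing, integral_prod_symm _ (integrable_torusPairing hF hr hr1 hX hY)]
  congr 1 with t
  rw [← integral_mul_const]
  congr 1 with s
  ring

theorem torusPairing_mul_mul (F : ℂ × ℂ → ℂ) (r : ℝ) (X Y : UnitAddCircle → ℂ) (a b : ℂ) :
    torusPairing F r (fun t => a * X t) (fun t => b * Y t) = a * b * torusPairing F r X Y := by
  rw [torusPairing, torusPairing, ← integral_const_mul]
  congr 1 with y
  ring

theorem torusPairing_add_add (hF : ContinuousOn F (unitDisk ×ˢ unitDisk)) (hr : 0 < r)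
    (hr1 : r < 1) {X X' Y Y' : UnitAddCircle → ℂ} (hX : Continuous X) (hX' : Continuous X')
    (hY : Continuous Y) (hY' : Continuous Y') :
    torusPairing F r (fun t => X t + X' t) (fun t => Y t + Y' t) =
      torusPairing F r X Y + torusPairing F r X Y' +
        (torusPairing F r X' Y + torusPairing F r X' Y') := by
  have hi {A B : UnitAddCircle → ℂ} (hA : Continuous A) (hB : Continuous B) :=
    integrable_torusPairing hF hr hr1 hA hB
  simp only [torusPairing]
  rw [← integral_add (hi hX hY) (hi hX hY'), ← integral_add (hi hX' hY) (hi hX' hY'),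
    ← integral_add ((hi hX hY).fun_add (hi hX hY')) ((hi hX' hY).fun_add (hi hX' hY'))]
  congr 1 with y
  ring

theorem iteratedDeriv_snd_eq_torusPairing (hF : DifferentiableOn ℂ F (unitDisk ×ˢ unitDisk))
    (hr1 : r < 1) {ζ w : ℂ} (hζ : ζ ∈ Metric.ball 0 r) (hw : w ∈ Metric.ball 0 r) (q : ℕ) :
    iteratedDeriv q (fun ω => F (ζ, ω)) w =
      torusPairing F r (cauchyKernel 0 r ζ) (cauchyKernel q r w) := by
  have hr : 0 < r := Metric.pos_of_mem_ball hζ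
  rw [torusPairing_eq_integral_integral_symm hF.continuousOn hr hr1 (continuous_cauchyKernel 0 hζ)
    (continuous_cauchyKernel q hw), ← integral_mul_cauchyKernel
    (differentiableOn_snd_of_bidisk hF (Metric.ball_subset_ball hr1.le hζ)) hr1 hw q]
  congr 1 with s
  rw [integral_mul_cauchyKernel_zero
    (differentiableOn_fst_of_bidisk hF (circlePoint_mem_unitDisk hr hr1 s)) hr1 hζ]

theorem mixedPartial_eq_torusPairing (hF : DifferentiableOn ℂ F (unitDisk ×ˢ unitDisk))
    (hr1 : r < 1) {z w : ℂ} (hz : z ∈ Metric.ball 0 r) (hw : w ∈ Metric.ball 0 r) (p q : ℕ) :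
    mixedPartial F p q z w = torusPairing F r (cauchyKernel p r z) (cauchyKernel q r w) := by
  have hr : 0 < r := Metric.pos_of_mem_ball hz
  have hFc := hF.continuousOn
  have hKw := continuous_cauchyKernel q hw
  have hG : Integrable fun t =>
      ∫ s, F (circlePoint r t, circlePoint r s) * cauchyKernel q r w s := by
    simpa using (integrable_torusPairing hFc hr hr1 (X := fun _ => 1) continuous_const
      hKw).integral_prod_left
  rw [torusPairing_eq_integral_integral hFc hr hr1 (continuous_cauchyKernel p hz) hKw,
    ← iteratedDeriv_integral_mul_cauchyKernel hG p hz, mixedPartial]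
  refine Filter.EventuallyEq.iteratedDeriv_eq p ?_
  filter_upwards [Metric.isOpen_ball.mem_nhds hz] with ζ hζ
  rw [iteratedDeriv_snd_eq_torusPairing hF hr1 hζ hw, torusPairing_eq_integral_integral hFc hr hr1
    (continuous_cauchyKernel 0 hζ) hKw]

theorem differentiableOn_schwarzian (hF : DifferentiableOn ℂ F (unitDisk ×ˢ unitDisk))
    (p q : ℕ) : DifferentiableOn ℂ (schwarzian F p q) unitDisk := by
  intro z₀ hz₀
  obtain ⟨r, hr0, hr1⟩ := exists_between (mem_ball_zero_iff.1 hz₀)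
  rw [← mem_ball_zero_iff] at hr0
  have hr : 0 < r := Metric.pos_of_mem_ball hr0
  let K (m n : ℕ) (z : ℂ) (y : UnitAddCircle × UnitAddCircle) : ℂ :=
    cauchyKernel m r z y.1 * cauchyKernel n r z y.2
  have hK (m n : ℕ) : ContinuousOn (fun y : ℂ × UnitAddCircle × UnitAddCircle => K m n y.1 y.2)
      (Metric.ball 0 r ×ˢ univ) :=
    ((continuousOn_cauchyKernel m r).comp
        (f := fun y : ℂ × UnitAddCircle × UnitAddCircle => (y.1, y.2.1)) (by fun_prop)
        fun y hy => ⟨hy.1, mem_univ _⟩).mul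
      ((continuousOn_cauchyKernel n r).comp
        (f := fun y : ℂ × UnitAddCircle × UnitAddCircle => (y.1, y.2.2)) (by fun_prop)
        fun y hy => ⟨hy.1, mem_univ _⟩)
  have hKd (y : UnitAddCircle × UnitAddCircle) (z : ℂ) (hz : z ∈ Metric.ball 0 r) :
      HasDerivAt (fun z => K p q z y) (K (p + 1) q z y + K p (q + 1) z y) z :=
    (hasDerivAt_cauchyKernel p y.1 hz).fun_mul (hasDerivAt_cauchyKernel q y.2 hz)
  have hd := hasDerivAt_integral_mul (μ := volume.prod volume) Metric.isOpen_ball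
    (K := K p q) (K' := fun z y => K (p + 1) q z y + K p (q + 1) z y)
    (fun z hz => (hK p q).comp_continuous (f := fun y => (z, y)) (by fun_prop)
      fun y => ⟨hz, mem_univ y⟩)
    ((hK (p + 1) q).add (hK p (q + 1))) hKd
    (integrable_of_continuous (continuous_comp_torus hF.continuousOn hr hr1)) hr0
  refine (hd.differentiableAt.congr_of_eventuallyEq ?_).differentiableWithinAt
  filter_upwards [Metric.isOpen_ball.mem_nhds hr0] with z hz
  exact mixedPartial_eq_torusPairing hF hr1 hz hz p q

theorem re_torusPairing (hF : DifferentiableOn ℂ F (unitDisk ×ˢ unitDisk)) (hr : 0 < r)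
    (hr1 : r < 1) {X Y : UnitAddCircle → ℂ} (hX : IsHardyCharge r X) (hY : IsHardyCharge r Y) :
    (torusPairing F r X Y).re =
      ∫ y, (F (circlePoint r y.1, circlePoint r y.2)).re * ((2 * (X y.1).re) * (2 * (Y y.2).re))
        ∂(volume.prod volume) := by
  have hFc := hF.continuousOn
  have hXc : Continuous fun t => conj (X t) := Complex.continuous_conj.comp hX.continuous
  have hYc : Continuous fun t => conj (Y t) := Complex.continuous_conj.comp hY.continuous
  have hX0 {Z : UnitAddCircle → ℂ} (hZ : Continuous Z) :
      torusPairing F r (fun t => conj (X t)) Z = 0 := by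
    rw [torusPairing_eq_integral_integral_symm hFc hr hr1 hXc hZ]
    simp_rw [hX.annihilates _
      (differentiableOn_fst_of_bidisk hF (circlePoint_mem_unitDisk hr hr1 _)), zero_mul]
    exact integral_zero _ _
  have hY0 : torusPairing F r X (fun t => conj (Y t)) = 0 := by
    rw [torusPairing_eq_integral_integral hFc hr hr1 hX.continuous hYc]
    simp_rw [hY.annihilates _
      (differentiableOn_snd_of_bidisk hF (circlePoint_mem_unitDisk hr hr1 _)), zero_mul]
    exact integral_zero _ _
  have hadd : torusPairing F r X Y =
      torusPairing F r (fun t => X t + conj (X t)) (fun t => Y t + conj (Y t)) := by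
    rw [torusPairing_add_add hFc hr hr1 hX.continuous hXc hY.continuous hYc,
      hX0 hY.continuous, hX0 hYc, hY0, add_zero, add_zero, add_zero]
  rw [hadd, torusPairing, ← RCLike.re_eq_complex_re, ← integral_re (integrable_torusPairing hFc hr
    hr1 (hX.continuous.fun_add hXc) (hY.continuous.fun_add hYc))]
  congr 1 with y
  rw [Complex.add_conj, Complex.add_conj, ← Complex.ofReal_mul, RCLike.re_eq_complex_re,
    Complex.re_mul_ofReal]

end TorusPairing

section Grunsky

theorem norm_le_mul_of_re_quadratic_le {H : Type*} [NormedAddCommGroup H] [InnerProductSpace ℂ H]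
    {v w : H} {α β γ : ℂ}
    (h : ∀ a b : ℂ, (a ^ 2 * α + 2 * (a * b * β) + b ^ 2 * γ).re ≤ ‖a • v + b • w‖ ^ 2) :
    ‖β‖ ≤ ‖v‖ * ‖w‖ := by
  have hre (a b : ℂ) : 2 * (a * b * β).re ≤ ‖a • v‖ ^ 2 + ‖b • w‖ ^ 2 := by
    have hsum := add_le_add (h a b) (h (Complex.I * a) (-Complex.I * b))
    have hpar := parallelogram_law_with_norm ℂ (a • v) (b • w)
    have hmul : ‖(Complex.I * a) • v + (-Complex.I * b) • w‖ = ‖a • v - b • w‖ := by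
      rw [mul_smul, mul_smul, neg_smul, ← sub_eq_add_neg, ← smul_sub, norm_smul, Complex.norm_I,
        one_mul]
    have hpoly : a ^ 2 * α + 2 * (a * b * β) + b ^ 2 * γ + ((Complex.I * a) ^ 2 * α +
        2 * (Complex.I * a * (-Complex.I * b) * β) + (-Complex.I * b) ^ 2 * γ) =
        (4 : ℝ) * (a * b * β) := by
      push_cast
      linear_combination (a ^ 2 * α - 2 * (a * b * β) + b ^ 2 * γ) * Complex.I_sq
    rw [hmul, ← Complex.add_re, hpoly, Complex.re_ofReal_mul] at hsum
    linarith
  have hnorm (x : ℝ) : 0 ≤ ‖w‖ ^ 2 * (x * x) + (-(2 * ‖β‖)) * x + ‖v‖ ^ 2 := by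
    obtain ⟨c, hc, hcβ⟩ : ∃ c : ℂ, ‖c‖ ≤ 1 ∧ c * β = ‖β‖ := by
      refine ⟨conj β / ‖β‖, ?_, ?_⟩
      · rw [norm_div, RCLike.norm_conj, Complex.norm_real, norm_norm]
        exact div_self_le_one _
      · rw [div_mul_eq_mul_div, Complex.conj_mul', sq, mul_self_div_self]
    have hx := hre 1 (x * c)
    have hle : ‖(x * c) • w‖ ^ 2 ≤ (|x| * ‖w‖) ^ 2 := by
      rw [norm_smul, norm_mul, Complex.norm_real, Real.norm_eq_abs]
      gcongr
      exact mul_le_of_le_one_right (abs_nonneg x) hc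
    rw [one_mul, mul_assoc, hcβ, ← Complex.ofReal_mul, Complex.ofReal_re, one_smul] at hx
    rw [mul_pow, sq_abs] at hle
    linarith
  have hdiscrim := discrim_le_zero hnorm
  rw [discrim] at hdiscrim
  exact abs_le_of_sq_le_sq' (by nlinarith) (by positivity) |>.2

variable {f : ℂ → ℂ} {F : ℂ × ℂ → ℂ}

theorem IsClassS.ne_zero (hf : IsClassS f) {z : ℂ} (hz : z ∈ unitDisk) (hz0 : z ≠ 0) :
    f z ≠ 0 := fun h =>
  hz0 (hf.injective hz (Metric.mem_ball_self one_pos) (h.trans hf.map_zero.symm))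

theorem IsLogBranch.inv_sub_inv (hf : IsClassS f) (hF : IsLogBranch f F) {z w : ℂ}
    (hz : z ∈ unitDisk) (hw : w ∈ unitDisk) (hz0 : z ≠ 0) (hw0 : w ≠ 0) :
    (f z)⁻¹ - (f w)⁻¹ = (z⁻¹ - w⁻¹) * Complex.exp (F (z, w)) := by
  obtain rfl | hwz := eq_or_ne w z
  · rw [sub_self, sub_self, zero_mul]
  have hfz := hf.ne_zero hz hz0
  have hfw := hf.ne_zero hw hw0
  have hsub : w - z ≠ 0 := sub_ne_zero.2 hwz
  rw [hF.exp_eq z hz w hw, quotient, dslope_of_ne _ hwz, dslope_of_ne _ hz0, dslope_of_ne _ hw0,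
    slope_def_field, slope_def_field, slope_def_field, hf.map_zero, sub_zero, sub_zero, sub_zero,
    sub_zero]
  field_simp

theorem IsLogBranch.norm_inv_sub_inv_sq (hf : IsClassS f) (hF : IsLogBranch f F) {r : ℝ}
    (hr : 0 < r) (hr1 : r < 1) (t s : UnitAddCircle) :
    ‖(r : ℂ) / f (circlePoint r t) - r / f (circlePoint r s)‖ ^ 2 =
      ‖(t.toCircle : ℂ) - s.toCircle‖ ^ 2 *
        Real.exp (2 * (F (circlePoint r t, circlePoint r s)).re) := by
  have hr0 : (r : ℂ) ≠ 0 := Complex.ofReal_ne_zero.2 hr.ne'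
  have hinv : (r : ℂ) * ((circlePoint r t)⁻¹ - (circlePoint r s)⁻¹) =
      conj ((t.toCircle : ℂ) - s.toCircle) := by
    rw [map_sub, ← Circle.coe_inv_eq_conj, ← Circle.coe_inv_eq_conj, Circle.coe_inv,
      Circle.coe_inv, circlePoint, circlePoint, mul_inv, mul_inv, ← mul_sub,
      mul_inv_cancel_left₀ hr0]
  rw [div_eq_mul_inv, div_eq_mul_inv, ← mul_sub, hF.inv_sub_inv hf
    (circlePoint_mem_unitDisk hr hr1 t) (circlePoint_mem_unitDisk hr hr1 s)
    (circlePoint_ne_zero hr t) (circlePoint_ne_zero hr s), ← mul_assoc, hinv, norm_mul,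
    RCLike.norm_conj, Complex.norm_exp, mul_pow, ← Real.exp_nat_mul, Nat.cast_two]

theorem re_torusPairing_self_le (hf : IsClassS f) (hF : IsLogBranch f F) {r : ℝ} (hr : 0 < r)
    (hr1 : r < 1) {X : UnitAddCircle → ℂ} (hX : IsHardyCharge r X)
    {v : lp (fun _ : ℕ => ℂ) 2} (hv : ⇑v = energyCoeff X) :
    (torusPairing F r X X).re ≤ ‖v‖ ^ 2 := by
  have hh : Continuous fun t => (r : ℂ) / f (circlePoint r t) :=
    continuous_const.div (continuous_comp_circlePoint hf.analytic.continuousOn hr hr1) fun t =>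
      hf.ne_zero (circlePoint_mem_unitDisk hr hr1 t) (circlePoint_ne_zero hr t)
  have hx : Continuous fun t => 2 * (X t).re :=
    continuous_const.mul (Complex.continuous_re.comp hX.continuous)
  have hsum : HasSum (fun k : ℕ =>
      ‖moment volume (fun t => (t.toCircle : ℂ)) (fun t => ((2 * (X t).re : ℝ) : ℂ)) k‖ ^ 2 / k)
      (‖v‖ ^ 2) := by
    simpa only [ENNReal.toReal_ofNat, Real.rpow_ofNat, hv, norm_energyCoeff_sq,
      ← hX.moment_two_mul_re hr] using lp.hasSum_norm (by simp) v
  rw [re_torusPairing hF.analytic hr hr1 hX hX, ← hsum.tsum_eq]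
  exact integral_distortion_le hh (by fun_prop)
    (fun t => Circle.norm_coe _)
    (Circle.coe_injective.comp (AddCircle.injective_toCircle one_ne_zero))
    (Complex.continuous_re.comp (continuous_comp_torus hF.analytic.continuousOn hr hr1))
    (hF.norm_inv_sub_inv_sq hf hr hr1) hx hX.integral_two_mul_re hsum.summable

theorem quotient_comm (f : ℂ → ℂ) (z w : ℂ) : quotient f z w = quotient f w z := by
  rw [quotient, quotient, dslope_comm f z w, mul_right_comm]

theorem IsLogBranch.re_comm (hF : IsLogBranch f F) {z w : ℂ} (hz : z ∈ unitDisk)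
    (hw : w ∈ unitDisk) : (F (z, w)).re = (F (w, z)).re := by
  rw [← Real.exp_eq_exp, ← Complex.norm_exp, ← Complex.norm_exp, hF.exp_eq z hz w hw,
    hF.exp_eq w hw z hz, quotient_comm]

theorem re_torusPairing_comm (hF : IsLogBranch f F) {r : ℝ} (hr : 0 < r)
    (hr1 : r < 1) {X Y : UnitAddCircle → ℂ} (hX : IsHardyCharge r X) (hY : IsHardyCharge r Y) :
    (torusPairing F r X Y).re = (torusPairing F r Y X).re := by
  rw [re_torusPairing hF.analytic hr hr1 hX hY, re_torusPairing hF.analytic hr hr1 hY hX,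
    ← integral_prod_swap]
  congr 1 with y
  rw [Prod.fst_swap, Prod.snd_swap, hF.re_comm (circlePoint_mem_unitDisk hr hr1 y.2)
    (circlePoint_mem_unitDisk hr hr1 y.1), mul_comm (2 * (X y.2).re)]

theorem torusPairing_comm (hF : IsLogBranch f F) {r : ℝ} (hr : 0 < r)
    (hr1 : r < 1) {X Y : UnitAddCircle → ℂ} (hX : IsHardyCharge r X) (hY : IsHardyCharge r Y) :
    torusPairing F r X Y = torusPairing F r Y X := by
  refine Complex.ext (re_torusPairing_comm hF hr hr1 hX hY) ?_
  have h := re_torusPairing_comm hF hr hr1 (hX.const_mul Complex.I) (hY.const_mul 1)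
  rw [torusPairing_mul_mul, torusPairing_mul_mul, mul_one, one_mul, Complex.I_mul_re,
    Complex.I_mul_re] at h
  exact neg_injective h

theorem norm_torusPairing_le (hf : IsClassS f) (hF : IsLogBranch f F) {r : ℝ} (hr : 0 < r)
    (hr1 : r < 1) {X Y : UnitAddCircle → ℂ} (hX : IsHardyCharge r X) (hY : IsHardyCharge r Y)
    {v w : lp (fun _ : ℕ => ℂ) 2} (hv : ⇑v = energyCoeff X) (hw : ⇑w = energyCoeff Y) :
    ‖torusPairing F r X Y‖ ≤ ‖v‖ * ‖w‖ := by
  refine norm_le_mul_of_re_quadratic_le (α := torusPairing F r X X) (γ := torusPairing F r Y Y)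
    fun a b => ?_
  have hXa := hX.const_mul a
  have hYb := hY.const_mul b
  have hcoeff : ⇑(a • v + b • w) = energyCoeff fun t => a * X t + b * Y t := by
    ext k
    rw [energyCoeff_add_mul hX.continuous hY.continuous, ← hv, ← hw]
    rfl
  refine le_of_eq_of_le (congrArg Complex.re ?_)
    (re_torusPairing_self_le hf hF hr hr1 (hXa.add hr hr1 hYb) hcoeff)
  rw [torusPairing_add_add hF.analytic.continuousOn hr hr1 hXa.continuous hYb.continuous
    hXa.continuous hYb.continuous]
  simp only [torusPairing_mul_mul]
  rw [torusPairing_comm hF hr hr1 hY hX]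
  ring

theorem norm_mixedPartial_le (hf : IsClassS f) (hF : IsLogBranch f F) {p q : ℕ}
    (hp : 1 ≤ p) (hq : 1 ≤ q) {r : ℝ} (hr1 : r < 1) {z w : ℂ} (hz : z ∈ Metric.ball 0 r)
    (hw : w ∈ Metric.ball 0 r) :
    ‖mixedPartial F p q z w‖ ≤
      (√(2 * p - 1).factorial * (r / (r ^ 2 - ‖z‖ ^ 2)) ^ p) *
        (√(2 * q - 1).factorial * (r / (r ^ 2 - ‖w‖ ^ 2)) ^ q) := by
  obtain ⟨u, hu, hle_u⟩ := exists_lp_energyCoeff_cauchyKernel hp hr1 hz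
  obtain ⟨v, hv, hle_v⟩ := exists_lp_energyCoeff_cauchyKernel hq hr1 hw
  rw [mixedPartial_eq_torusPairing hF.analytic hr1 hz hw]
  exact (norm_torusPairing_le hf hF (Metric.pos_of_mem_ball hz) hr1
    (isHardyCharge_cauchyKernel hp hr1 hz) (isHardyCharge_cauchyKernel hq hr1 hw) hu hv).trans
    (mul_le_mul hle_u hle_v (norm_nonneg v) ((norm_nonneg u).trans hle_u))

theorem norm_schwarzian_mul_le (hf : IsClassS f) (hF : IsLogBranch f F) {p q : ℕ}
    (hp : 1 ≤ p) (hq : 1 ≤ q) {z : ℂ} (hz : z ∈ unitDisk) :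
    ‖schwarzian F p q z‖ * (1 - ‖z‖ ^ 2) ^ ((p : ℝ) + (q : ℝ)) ≤
      √((2 * p - 1).factorial * (2 * q - 1).factorial) := by
  have hz1 : ‖z‖ < 1 := mem_ball_zero_iff.1 hz
  have hpos : 0 < 1 - ‖z‖ ^ 2 := by nlinarith [norm_nonneg z]
  let bound (r : ℝ) : ℝ := (√(2 * p - 1).factorial * (r / (r ^ 2 - ‖z‖ ^ 2)) ^ p) *
    (√(2 * q - 1).factorial * (r / (r ^ 2 - ‖z‖ ^ 2)) ^ q)
  have hcont : ContinuousAt bound 1 := by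
    have hdiv : ContinuousAt (fun r : ℝ => r / (r ^ 2 - ‖z‖ ^ 2)) 1 :=
      ContinuousAt.div (by fun_prop) (by fun_prop) (by simpa using hpos.ne')
    fun_prop
  have hle : ‖schwarzian F p q z‖ ≤ bound 1 := by
    refine ge_of_tendsto (hcont.tendsto.mono_left (nhdsWithin_le_nhds (s := Iio 1))) ?_
    filter_upwards [Ioo_mem_nhdsLT hz1] with r hr
    exact norm_mixedPartial_le hf hF hp hq hr.2 (mem_ball_zero_iff.2 hr.1)
      (mem_ball_zero_iff.2 hr.1)
  rw [← Nat.cast_add, Real.rpow_natCast, Real.sqrt_mul (by positivity),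
    ← le_div_iff₀ (by positivity)]
  refine hle.trans_eq ?_
  simp only [bound, one_pow, one_div, inv_pow]
  rw [pow_add]
  field_simp

end Grunsky

end HigherSchwarzian

theorem proposition3p2 (f : ℂ → ℂ) (hf : HigherSchwarzian.IsClassS f)
    (p q : ℕ) (hp : 1 ≤ p) (hq : 1 ≤ q) :
    (∃ F : ℂ × ℂ → ℂ, HigherSchwarzian.IsLogBranch f F) ∧
    ∀ F : ℂ × ℂ → ℂ, HigherSchwarzian.IsLogBranch f F →
      HigherSchwarzian.MemGrowth ((p : ℝ) + (q : ℝ)) (HigherSchwarzian.schwarzian F p q) ∧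
      HigherSchwarzian.growthNorm ((p : ℝ) + (q : ℝ)) (HigherSchwarzian.schwarzian F p q) ≤
        Real.sqrt ((Nat.factorial (2 * p - 1) : ℝ) * (Nat.factorial (2 * q - 1) : ℝ)) := by
  refine ⟨HigherSchwarzian.exists_isLogBranch hf, fun F hF => ?_⟩
  have hle := fun z : HigherSchwarzian.unitDisk =>
    HigherSchwarzian.norm_schwarzian_mul_le hf hF hp hq z.2
  refine ⟨⟨HigherSchwarzian.differentiableOn_schwarzian hF.analytic p q, ?_⟩, ?_⟩
  · exact ⟨_, forall_mem_range.2 hle⟩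
  · have : Nonempty HigherSchwarzian.unitDisk := ⟨⟨0, by simp [HigherSchwarzian.unitDisk]⟩⟩
    exact ciSup_le hle
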